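/- Let $d\ge 1$, let $\mathcal H$ be a separable complex Hilbert space, and write $|n|=\max_k|n_k|$ for $n\in\mathbb Z^d$. Write $\ell^q(\mathcal H)=\ell^q(\mathbb Z^d,\mathcal H)$, $\ell^q=\ell^q(\mathbb Z^d,\mathbb C)$ for $q\in[1,\infty]$, and let the index $q=0$ stand for the spaces $\mathfrak c_0(\mathcal H)$, $\mathfrak c_0$ of sequences vanishing at infinity, with the sup norm. For $f=(f_m)$, $g=(g_m)$ put $\langle f,g\rangle=\sum_m\langle f_m,g_m\rangle$. *Definitions.* Let $\varphi^n=(\varphi^n_m)_m\in\ell^1(\mathcal H)$, $n\in\mathbb Z^d$, and $Tf=(\langle f,\varphi^n\rangle)_{n\in\mathbb Z^d}$. For $p\in[1,\infty)$, $\varphi$ is a $p$-frame if for some $0<a\le b<\infty$ one has $a\|f\|_p^p\le\sum_n|\langle f,\varphi^n\rangle|^p\le b\|f\|_p^p$ for all $f\in\ell^p(\mathcal H)$; it is an $\infty$-frame (a $0$-frame) if $a\|f\|_\infty\le\sup_n|\langle f,\varphi^n\rangle|\le b\|f\|_\infty$ for all $f\in\ell^\infty(\mathcal H)$ (for all $f\in\mathfrak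 c_0(\mathcal H)$). Let $\alpha\in\mathbb R\setminus\{0\}$ and $s>1$. A matrix $A=(a_{mn})_{m,n\in\mathbb Z^d}$ of bounded operators $a_{mn}:\mathcal H\to\mathbb C$ is in $\Sigma^\omega_\alpha$, $\omega(j)=(1+|j|)^s$, if $\lceil|\alpha^{-1}|\rceil^d\sum_{j\in\mathbb Z^d}\|A_j\|_{\sup}\,\omega(j)<\infty$, where $\|A_j\|_{\sup}$ is the supremum of $\|a_{mn}\|$ over all $m,n$ with $\alpha m_k-n_k\in[j_k,j_k+1)$ for $k=1,\dots,d$. A $p$-frame $\varphi$, $p\in\{0\}\cup[1,\infty]$, is $(s,\alpha)$-localized if there is an isomorphism $J$ of $\ell^\infty(\mathcal H)$ (a bounded linear bijection with bounded inverse) that maps $\mathfrak c_0(\mathcal H)$ onto itself and $\ell^q(\mathcal H)$ onto itself for every $q\in[1,\infty)$, such that the restriction of $TJ$ to $\ell^p(\mathcal H)$ (to $\mathfrak c_0(\mathcal H)$ if $p=0$) is given by a matrix in $\Sigma^\omega_\alpha$. **Theorem.** Let $\varphi=(\varphi^n)_{n\in\mathbb Z^d}$ be an $(s,\alpha)$-localized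 $p$-frame for some $p\in\{0\}\cup[1,\infty]$, with $s>(d+1)^2$. Then: (i) For every $q\in\{0\}\cup[1,\infty]$ the analysis operator $T:\ell^q(\mathcal H)\to\ell^q$ ($T:\mathfrak c_0(\mathcal H)\to\mathfrak c_0$ for $q=0$) is well defined, bounded and left invertible (it has a bounded linear left inverse). Its adjoint $T^*c=\sum_n c_n\varphi^n$ (summed coordinatewise) is a well-defined bounded operator from $\ell^q$ to $\ell^q(\mathcal H)$ (from $\mathfrak c_0$ to $\mathfrak c_0(\mathcal H)$ for $q=0$), $T^*T$ is an isomorphism of $\ell^q(\mathcal H)$ (of $\mathfrak c_0(\mathcal H)$ for $q=0$), and so the synthesis operator $T^\sharp=(T^*T)^{-1}T^*$ is well defined and bounded. (ii) The canonical dual sequence $\tilde\varphi^n=(T^*T)^{-1}\varphi^n$ lies in $\ell^1(\mathcal H)$ and does not depend on $q$, and both $(\varphi^n)$ and $(\tilde\varphi^n)$ are $(s,\alpha)$-localized $q$-frames for all $q\in\{0\}\cup[1,\infty]$. (iii) For $f$ in $\mathfrak c_0(\mathcal H)$ or in $\ell^q(\mathcal H)$, $q\in[1,\infty]$, $$f=T^\sharp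 Tf=\sum_{n\in\mathbb Z^d}\langle f,\varphi^n\rangle\tilde\varphi^n=\sum_{n\in\mathbb Z^d}\langle f,\tilde\varphi^n\rangle\varphi^n,$$ where the series converge unconditionally in norm if $f\in\mathfrak c_0(\mathcal H)$ or $q<\infty$, and unconditionally in the weak$^*$ topology (with predual $\ell^1(\mathcal H)$) if $q=\infty$. Consequently $(\varphi^n)$ is a Banach frame for $\mathfrak c_0(\mathcal H)$ and for every $\ell^q(\mathcal H)$, $q\in[1,\infty]$, with associated sequence space $\mathfrak c_0$, respectively $\ell^q$: there are $C\ge1$ and a bounded operator $R$ from the sequence space to the space such that $C^{-1}\|f\|\le\|(\langle f,\varphi^n\rangle)_n\|\le C\|f\|$ and $R\big((\langle f,\varphi^n\rangle)_n\big)=f$ for all $f$. -/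

import Mathlib

open scoped ENNReal
open Filter Topology

namespace SlantedFrames

/-- The index group `ℤ^d`. Its norm is `|n| = max_k |n_k|`. -/
abbrev Idx (d : ℕ) : Type := Fin d → ℤ

/-- The set `{0} ∪ [1, ∞]` of exponents; `0` stands for the space `𝔠₀`. -/
abbrev Exponent : Type := {q : ℝ≥0∞ // q = 0 ∨ 1 ≤ q}

/-- The exponent whose norm is used: the sup norm for `𝔠₀`, the `q`-norm otherwise. -/
noncomputable def Exponent.normExp (q : Exponent) : ℝ≥0∞ := if q.1 = 0 then ∞ else q.1

theorem Exponent.one_le_normExp (q : Exponent) : 1 ≤ q.normExp := by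
  unfold Exponent.normExp
  split_ifs with h
  · exact le_top
  · exact q.2.resolve_left h

instance (q : Exponent) : Fact (1 ≤ q.normExp) := ⟨q.one_le_normExp⟩

/-- The space `ℓ^q(ℤ^d, E)` for `q ∈ [1, ∞]`, and the space `𝔠₀(ℤ^d, E)` (with the sup norm, as a
subspace of `ℓ^∞`) for `q = 0`. -/
noncomputable def SeqSpace (d : ℕ) (E : Type*) [NormedAddCommGroup E] [NormedSpace ℂ E]
    (q : Exponent) : Submodule ℂ (lp (fun _ : Idx d => E) q.normExp) where
  carrier := {f | q.1 = 0 → Tendsto (fun n => f n) cofinite (𝓝 0)}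
  add_mem' := by
    intro f g hf hg h
    have := (hf h).add (hg h)
    simpa using this
  zero_mem' := by
    intro _
    exact tendsto_const_nhds
  smul_mem' := by
    intro c f hf h
    have := (hf h).const_smul c
    simpa using this

/-- Membership of a plain sequence in `ℓ^q(ℤ^d, E)`, respectively in `𝔠₀(ℤ^d, E)` for `q = 0`. -/
def MemSeq {d : ℕ} {E : Type*} [NormedAddCommGroup E] (q : Exponent) (f : Idx d → E) : Prop :=
  Memℓp f q.normExp ∧ (q.1 = 0 → Tendsto f cofinite (𝓝 0))

/-- The underlying sequence of an element of `SeqSpace`, as a linear map. -/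
noncomputable def SeqSpace.coord (d : ℕ) (E : Type*) [NormedAddCommGroup E] [NormedSpace ℂ E]
    (q : Exponent) : SeqSpace d E q →ₗ[ℂ] (Idx d → E) where
  toFun f := fun n => f.1 n
  map_add' _ _ := rfl
  map_smul' _ _ := rfl

/-- An element of `ℓ^1(ℤ^d, E)` belongs to `𝔠₀` and to all `ℓ^q`. -/
theorem memSeq_of_l1 {d : ℕ} {E : Type*} [NormedAddCommGroup E] (q : Exponent)
    (g : lp (fun _ : Idx d => E) 1) : MemSeq q (fun n => g n) := by
  refine ⟨(lp.memℓp g).of_exponent_ge q.one_le_normExp, fun _ => ?_⟩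
  have h := (lp.memℓp g).summable (by norm_num)
  simp only [ENNReal.toReal_one, Real.rpow_one] at h
  exact tendsto_zero_iff_norm_tendsto_zero.2 h.tendsto_cofinite_zero

/-- The inclusion of `ℓ^1(ℤ^d, E)` into `ℓ^q(ℤ^d, E)`, respectively into `𝔠₀(ℤ^d, E)`. -/
noncomputable def ofL1 {d : ℕ} {E : Type*} [NormedAddCommGroup E] [NormedSpace ℂ E] (q : Exponent)
    (g : lp (fun _ : Idx d => E) 1) : SeqSpace d E q :=
  ⟨⟨fun n => g n, (memSeq_of_l1 q g).1⟩, (memSeq_of_l1 q g).2⟩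

section Matrices

variable {d : ℕ} {E F : Type*} [NormedAddCommGroup E] [NormedSpace ℂ E]
  [NormedAddCommGroup F] [NormedSpace ℂ F]

open Classical in
/-- The `j`-th `α`-slant of the operator matrix `A = (a_{mn})`. -/
noncomputable def slant (α : ℝ) (j : Idx d) (A : Idx d → Idx d → (E →L[ℂ] F)) :
    Idx d → Idx d → (E →L[ℂ] F) := fun m n =>
  if ∀ k, (j k : ℝ) ≤ α * (m k : ℝ) - (n k : ℝ) ∧ α * (m k : ℝ) - (n k : ℝ) < (j k : ℝ) + 1
  then A m n else 0

/-- The norm `K ∑_j ‖A_j‖_sup ω(j)`, `K = ⌈|α⁻¹|⌉^d`, with values in `[0, ∞]`. -/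
noncomputable def slantedNorm (α : ℝ) (ω : Idx d → ℝ) (A : Idx d → Idx d → (E →L[ℂ] F)) : ℝ≥0∞ :=
  ((⌈|α⁻¹|⌉₊ ^ d : ℕ) : ℝ≥0∞) *
    ∑' j : Idx d, (⨆ m : Idx d, ⨆ n : Idx d, ‖slant α j A m n‖ₑ) * ENNReal.ofReal (ω j)

/-- The class `Σ_α^ω` of matrices with `ω`-summable `α`-slants. -/
def MemSigma (α : ℝ) (ω : Idx d → ℝ) (A : Idx d → Idx d → (E →L[ℂ] F)) : Prop :=
  slantedNorm α ω A < ∞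

end Matrices

/-- The weight `ω(n) = (1 + |n|)^s` on `ℤ^d`. -/
noncomputable def polyWeight (d : ℕ) (s : ℝ) (n : Idx d) : ℝ := (1 + ‖n‖) ^ s

theorem hasSum_norm_l1 {d : ℕ} {E : Type*} [NormedAddCommGroup E]
    (g : lp (fun _ : Idx d => E) 1) : HasSum (fun m => ‖g m‖) ‖g‖ := by
  simpa using lp.hasSum_norm (p := 1) (by norm_num) g

section Frames

variable {d : ℕ} {H : Type*} [NormedAddCommGroup H] [InnerProductSpace ℂ H]

/-- `⟨f, g⟩ = ∑_m ⟨f_m, g_m⟩`, linear in `f` and conjugate linear in `g`; the series converges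
absolutely if one sequence is in `ℓ^1` and the other is bounded. -/
noncomputable def pairing (f g : Idx d → H) : ℂ := ∑' m, inner ℂ (g m) (f m)

theorem norm_apply_le (q : Exponent) (f : SeqSpace d H q) (m : Idx d) : ‖f.1 m‖ ≤ ‖f‖ :=
  lp.norm_apply_le_norm (fun h => by
    have := q.one_le_normExp
    rw [h] at this
    simp at this) f.1 m

theorem summable_pairing (q : Exponent) (g : lp (fun _ : Idx d => H) 1) (f : SeqSpace d H q) :
    Summable (fun m => ‖inner ℂ (g m) (f.1 m)‖) := by
  refine Summable.of_nonneg_of_le (fun _ => norm_nonneg _) (fun m => ?_)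
    ((hasSum_norm_l1 g).summable.mul_right ‖f‖)
  exact (norm_inner_le_norm _ _).trans
    (mul_le_mul_of_nonneg_left (norm_apply_le q f m) (norm_nonneg _))

/-- The continuous functional `f ↦ ⟨f, g⟩` on `ℓ^q(ℤ^d, H)` (or `𝔠₀`) given by `g ∈ ℓ^1(ℤ^d, H)`. -/
noncomputable def functional (q : Exponent) (g : lp (fun _ : Idx d => H) 1) :
    StrongDual ℂ (SeqSpace d H q) :=
  LinearMap.mkContinuous
    { toFun := fun f => pairing (fun m => f.1 m) (fun m => g m)
      map_add' := fun f f' => by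
        have h := (summable_pairing q g f).of_norm.tsum_add (summable_pairing q g f').of_norm
        simp only [pairing]
        rw [← h]
        exact tsum_congr fun m => inner_add_right _ _ _
      map_smul' := fun c f => by
        simp only [pairing, RingHom.id_apply, smul_eq_mul]
        rw [← tsum_mul_left]
        exact tsum_congr fun m => inner_smul_right _ _ _ }
    ‖g‖ (fun f => by
      refine tsum_of_norm_bounded ((hasSum_norm_l1 g).mul_right ‖f‖) fun m => ?_
      exact (norm_inner_le_norm _ _).trans
        (mul_le_mul_of_nonneg_left (norm_apply_le q f m) (norm_nonneg _)))

/-- The sequence `Tf = (⟨f, φ^n⟩)_n`. -/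
noncomputable def analysis (φ : Idx d → lp (fun _ : Idx d => H) 1) (f : Idx d → H) : Idx d → ℂ :=
  fun n => pairing f (fun m => φ n m)

open Classical in
/-- `φ` is a `p`-frame for `ℓ^p(ℤ^d, H)` (for `𝔠₀(ℤ^d, H)` if `p = 0`). -/
def IsFrame (p : Exponent) (φ : Idx d → lp (fun _ : Idx d => H) 1) : Prop :=
  ∃ a b : ℝ, 0 < a ∧ a ≤ b ∧ ∀ f : SeqSpace d H p,
    if p.1 = 0 ∨ p.1 = ∞ then
      BddAbove (Set.range fun n => ‖analysis φ (fun m => f.1 m) n‖) ∧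
      a * ‖f‖ ≤ ⨆ n, ‖analysis φ (fun m => f.1 m) n‖ ∧
      ⨆ n, ‖analysis φ (fun m => f.1 m) n‖ ≤ b * ‖f‖
    else
      Summable (fun n => ‖analysis φ (fun m => f.1 m) n‖ ^ p.1.toReal) ∧
      a * ‖f‖ ^ p.1.toReal ≤ ∑' n, ‖analysis φ (fun m => f.1 m) n‖ ^ p.1.toReal ∧
      ∑' n, ‖analysis φ (fun m => f.1 m) n‖ ^ p.1.toReal ≤ b * ‖f‖ ^ p.1.toReal

/-- `φ` is an `(s, α)`-localized `p`-frame: there is an isomorphism `J` of `ℓ^∞(ℤ^d, H)` that maps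
`𝔠₀` onto `𝔠₀` and each `ℓ^q` onto `ℓ^q`, such that the restriction of `TJ` to `ℓ^p`
(to `𝔠₀` if `p = 0`) is the operator of a matrix in `Σ_α^ω`, `ω(n) = (1 + |n|)^s`. -/
def IsLocalizedFrame (s α : ℝ) (p : Exponent) (φ : Idx d → lp (fun _ : Idx d => H) 1) : Prop :=
  1 < s ∧ α ≠ 0 ∧ IsFrame p φ ∧
  ∃ J : lp (fun _ : Idx d => H) ∞ ≃L[ℂ] lp (fun _ : Idx d => H) ∞,
    (∀ (q : Exponent) (f : lp (fun _ : Idx d => H) ∞),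
      MemSeq q (fun m => J f m) ↔ MemSeq q (fun m => f m)) ∧
    ∃ A : Idx d → Idx d → (H →L[ℂ] ℂ), MemSigma α (polyWeight d s) A ∧
      ∀ f : lp (fun _ : Idx d => H) ∞, MemSeq p (fun m => f m) →
        ∀ n, analysis φ (fun m => J f m) n = ∑' m, A n m (f m)

/-- `T` is the `q`-analysis operator of `φ`: `(Tf)_n = ∑_m ⟨f_m, φ^n_m⟩`. -/
def IsAnalysisOperator (q : Exponent) (φ : Idx d → lp (fun _ : Idx d => H) 1)
    (T : SeqSpace d H q →L[ℂ] SeqSpace d ℂ q) : Prop :=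
  ∀ f n, (T f).1 n = analysis φ (fun m => f.1 m) n

/-- `S` is the adjoint `T^*` of the analysis operator, acting on `ℓ^q(ℤ^d)` (on `𝔠₀(ℤ^d)` if
`q = 0`), i.e. the operator of the adjoint matrix: `(T^* c)_m = ∑_n c_n φ^n_m`. -/
def IsAdjointOperator (q : Exponent) (φ : Idx d → lp (fun _ : Idx d => H) 1)
    (S : SeqSpace d ℂ q →L[ℂ] SeqSpace d H q) : Prop :=
  ∀ c m, HasSum (fun n => c.1 n • φ n m) ((S c).1 m)

/-- `∑_n F_n = f` in the weak* topology of `ℓ^∞(ℤ^d, H)`, whose predual is `ℓ^1(ℤ^d, H)`. -/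
def HasWeakStarSum (F : Idx d → Idx d → H) (f : Idx d → H) : Prop :=
  ∀ g : lp (fun _ : Idx d => H) 1,
    HasSum (fun n => pairing (F n) (fun m => g m)) (pairing f (fun m => g m))

/-- `∑_n F_n = f`, in norm in `𝔠₀` and in `ℓ^q` with `q < ∞`, and in the weak* topology
in `ℓ^∞`. -/
def HasSeriesSum (q : Exponent) (F : Idx d → SeqSpace d H q) (f : SeqSpace d H q) : Prop :=
  (q.1 ≠ ∞ → HasSum F f) ∧
  (q.1 = ∞ → HasWeakStarSum (fun n m => (F n).1 m) (fun m => f.1 m))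

end Frames

/-- The sequence `x` in the dual of `X` is a Banach frame for `X` with associated sequence space
`Xd`, where `coord` maps an element of `Xd` to its sequence of entries. -/
def IsBanachFrame {ι X Xd : Type*} [NormedAddCommGroup X] [NormedSpace ℂ X]
    [NormedAddCommGroup Xd] [NormedSpace ℂ Xd] (coord : Xd →ₗ[ℂ] (ι → ℂ))
    (x : ι → StrongDual ℂ X) : Prop :=
  Function.Injective coord ∧
  ∃ C : ℝ, 1 ≤ C ∧ ∃ R : Xd →L[ℂ] X, ∀ f : X, ∃ c : Xd,
    coord c = (fun n => x n f) ∧ 1 / C * ‖f‖ ≤ ‖c‖ ∧ ‖c‖ ≤ C * ‖f‖ ∧ R c = f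

end SlantedFrames

/-!
The analysis operator of a localized frame is `T = A J⁻¹`, where `A` is a slanted matrix with
polynomial off-diagonal decay. The theorem amounts to the invertibility of `T^* T` on all the spaces
`ℓ^q` and `𝔠₀` at once, which is obtained from a lower bound for `A` on a single one of them. No
Wiener type lemma for inverse-closed matrix algebras is needed.

*Stability* (`exists_pointwise_bound`). Let `A` be bounded below on `ℓ^p`, and let
`w_x(n) = (1 + |n - x| / N)^(-d-1)`. Since `|w_x(n) - w_x(αm)|` is at most
`w_x(n) (1 + |αm - n|)^(d+1) / N`, the commutator of `A` with multiplication by `w_x` is a matrix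
of norm `O(1 / N)` applied to `w_x f`. For `N` large it is absorbed by the lower bound, so that
`‖f(x)‖ ≤ ‖w_x f‖_p ≤ C ‖w_x(α·) A f‖_p ≤ C ∑_m w_x(αm) |(A f)(m)|` for every bounded `f`. The
kernel `w_x(αm)` satisfies the Schur test; hence `A` is bounded below on every `ℓ^q`.

*Inversion of the Gram operator* (`exists_gram_inverse`). In particular `A` is bounded below on
`ℓ^2`, where `A^* A` is therefore invertible. The matrix `A^* A` is again slanted, with `α = 1`, and
bounded below on `ℓ^2`, so the pointwise bound applies to it and shows that the columns of the
inverse are dominated by a Schur kernel. The inverse is thus an operator on all the spaces.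

*Duality* (`exists_isAdj`). The isomorphism `J` need not be weak* continuous on `ℓ^∞`. It is
replaced by the biadjoint `W` of its restriction to `𝔠₀`. Adjoints are built coordinatewise with the
Riesz representation theorem; they respect `ℓ^q` by the converse of Hölder's inequality. Boundedness
on each space follows from the closed graph theorem (`seqMap`), so that everything else can be done
with operators on `ℓ^∞` and the pairing between `ℓ^1` and `ℓ^∞`.

*Conclusion.* With `S = T^* T` the analysis operator of the dual sequence is `T S⁻¹`, and
`(T S⁻¹) (S W) = T W = A`, so the dual sequence is localized with the same matrix `A`. The
reconstruction formulas are synthesis series (`IsAnalysisPair.hasSeriesSum`). The coordinatewise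
convergence of `∑ c_n φ^n` for bounded `c` rests on the fact that weakly unconditionally Cauchy
series in a Hilbert space converge (`summable_of_bounded_coeff`).
-/

namespace SlantedFrames

/-! ### Sequence spaces inside `ℓ^∞` -/

/-- The space `ℓ^∞(ℤ^d, E)`, the ambient space of all `ℓ^q(ℤ^d, E)` and of `𝔠₀(ℤ^d, E)`. -/
abbrev Linf (d : ℕ) (E : Type*) [NormedAddCommGroup E] : Type _ := lp (fun _ : Idx d => E) ∞

section Groups

variable {d : ℕ} {E : Type*} [NormedAddCommGroup E]

theorem Exponent.normExp_ne_zero (q : Exponent) : q.normExp ≠ 0 :=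
  (zero_lt_one.trans_le q.one_le_normExp).ne'

theorem MemSeq.memLinf {q : Exponent} {f : Idx d → E} (h : MemSeq q f) : Memℓp f ∞ :=
  h.1.of_exponent_ge le_top

theorem memSeq_of_memℓp_one (q : Exponent) {f : Idx d → E} (h : Memℓp f 1) : MemSeq q f :=
  memSeq_of_l1 q ⟨f, h⟩

theorem memSeq_top (f : Linf d E) : MemSeq ⟨∞, Or.inr le_top⟩ (fun n => f n) := by
  refine ⟨?_, fun h => absurd h (by simp)⟩
  simpa [Exponent.normExp] using lp.memℓp f

theorem memSeq_one_iff {f : Idx d → E} : MemSeq ⟨1, Or.inr le_rfl⟩ f ↔ Memℓp f 1 := by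
  simp [MemSeq, Exponent.normExp]

theorem memSeq_zero_iff {f : Idx d → E} (hf : Memℓp f ∞) :
    MemSeq ⟨0, Or.inl rfl⟩ f ↔ Tendsto f cofinite (𝓝 0) := by
  simp [MemSeq, Exponent.normExp, hf]

/-- For finite nonzero exponents, membership means summability of `‖f_n‖^q`. -/
theorem memSeq_iff_summable {q : Exponent} (h0 : q.1 ≠ 0) (ht : q.1 ≠ ∞) {f : Idx d → E} :
    MemSeq q f ↔ Summable fun n => ‖f n‖ ^ q.1.toReal := by
  have hq : 0 < q.1.toReal := ENNReal.toReal_pos h0 ht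
  simp only [MemSeq, h0, false_imp_iff, and_true, Exponent.normExp, if_false]
  exact memℓp_gen_iff hq

theorem Exponent.one_le_toReal {q : Exponent} (h0 : q.1 ≠ 0) (ht : q.1 ≠ ∞) : 1 ≤ q.1.toReal := by
  have h := q.2.resolve_left h0
  rw [← ENNReal.toReal_one]
  exact ENNReal.toReal_mono ht h

theorem isClosed_null : IsClosed {f : Linf d E | Tendsto (fun n => f n) cofinite (𝓝 0)} := by
  refine isClosed_of_closure_subset fun f hf => ?_
  rw [Set.mem_ofPred_eq, Metric.tendsto_nhds]
  intro ε hε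
  obtain ⟨g, hg, hfg⟩ := Metric.mem_closure_iff.1 hf (ε / 2) (half_pos hε)
  filter_upwards [(Metric.tendsto_nhds.1 hg) (ε / 2) (half_pos hε)] with n hn
  rw [dist_zero_right] at hn ⊢
  have h1 : ‖(f - g) n‖ ≤ ‖f - g‖ := lp.norm_apply_le_norm (by simp) _ n
  rw [dist_eq_norm] at hfg
  calc ‖f n‖ = ‖(f - g) n + g n‖ := by simp
    _ ≤ ‖(f - g) n‖ + ‖g n‖ := norm_add_le _ _
    _ < ε := by linarith

theorem memℓp_one_single (n : Idx d) (h : E) :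
    Memℓp (fun m => (lp.single ∞ n h : Linf d E) m) 1 := by
  have := lp.memℓp (lp.single 1 n h : lp (fun _ : Idx d => E) 1)
  simpa only [lp.coeFn_single] using this

theorem hasSum_null {f : Linf d E} (hf : Tendsto (fun n => f n) cofinite (𝓝 0)) :
    HasSum (fun n => (lp.single ∞ n (f n) : Linf d E)) f := by
  rw [HasSum, SummationFilter.unconditional_filter, Metric.tendsto_atTop]
  intro ε hε
  have h1 : {n | ¬ ‖f n‖ < ε / 2}.Finite := by
    have := (Metric.tendsto_nhds.1 hf) (ε / 2) (half_pos hε)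
    simpa [Filter.eventually_cofinite] using this
  refine ⟨h1.toFinset, fun s hs => ?_⟩
  rw [dist_eq_norm]
  refine lt_of_le_of_lt (lp.norm_le_of_forall_le (half_pos hε).le fun n => ?_) (half_lt_self hε)
  have h2 : (∑ i ∈ s, (lp.single ∞ i (f i) : Linf d E)) n = if n ∈ s then f n else 0 := by
    rw [lp.coeFn_sum, Finset.sum_apply]
    simp only [lp.single_apply, Pi.single_apply]
    simp
  rw [lp.coeFn_sub, Pi.sub_apply, h2]
  split_ifs with h3
  · simpa using (half_pos hε).le
  · rw [zero_sub, norm_neg]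
    by_contra h4
    exact h3 (hs (h1.mem_toFinset.2 fun h => h4 h.le))

end Groups

section Spaces

variable {d : ℕ} {E F G : Type*} [NormedAddCommGroup E] [NormedSpace ℂ E]
  [NormedAddCommGroup F] [NormedSpace ℂ F] [NormedAddCommGroup G] [NormedSpace ℂ G]

theorem memSeq_coe (q : Exponent) (f : SeqSpace d E q) : MemSeq q (fun n => f.1 n) :=
  ⟨lp.memℓp f.1, f.2⟩

theorem SeqSpace.norm_le_iff_top {q : Exponent} (h : q.1 = 0 ∨ q.1 = ∞) (f : SeqSpace d E q)
    {C : ℝ} (hC : 0 ≤ C) : ‖f‖ ≤ C ↔ ∀ n, ‖f.1 n‖ ≤ C := by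
  constructor
  · exact fun hf n => (lp.norm_apply_le_norm q.normExp_ne_zero f.1 n).trans hf
  · intro hf
    have hq : q.normExp = ∞ := by
      unfold Exponent.normExp
      rcases h with h | h <;> simp [h]
    have key : ∀ (r : ℝ≥0∞), r = ∞ → ∀ g : lp (fun _ : Idx d => E) r,
        (∀ n, ‖g n‖ ≤ C) → ‖g‖ ≤ C := by
      rintro r rfl g hg
      exact lp.norm_le_of_forall_le hC hg
    exact key _ hq f.1 hf

theorem SeqSpace.hasSum_norm {q : Exponent} (h0 : q.1 ≠ 0) (ht : q.1 ≠ ∞) (f : SeqSpace d E q) :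
    HasSum (fun n => ‖f.1 n‖ ^ q.1.toReal) (‖f‖ ^ q.1.toReal) := by
  have hq : q.normExp = q.1 := by simp [Exponent.normExp, h0]
  have h := lp.hasSum_norm (p := q.normExp) (by rw [hq]; exact ENNReal.toReal_pos h0 ht) f.1
  have hr : q.normExp.toReal = q.1.toReal := by rw [hq]
  simp only [hr] at h
  exact h

/-- The bounded inclusion of `ℓ^q` (or `𝔠₀`) into `ℓ^∞`. -/
noncomputable def toLinf (q : Exponent) : SeqSpace d E q →L[ℂ] Linf d E :=
  LinearMap.mkContinuous
    { toFun := fun f => ⟨fun n => f.1 n, (memSeq_coe q f).memLinf⟩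
      map_add' := fun _ _ => rfl
      map_smul' := fun _ _ => rfl } 1
    (fun f => by
      rw [one_mul]
      exact lp.norm_le_of_forall_le (norm_nonneg f)
        fun n => lp.norm_apply_le_norm q.normExp_ne_zero f.1 n)

@[simp] theorem toLinf_apply (q : Exponent) (f : SeqSpace d E q) (n : Idx d) :
    toLinf q f n = f.1 n := rfl

theorem toLinf_injective (q : Exponent) :
    Function.Injective (toLinf q : SeqSpace d E q → Linf d E) := by
  intro f g h
  refine Subtype.ext (lp.ext (funext fun n => ?_))
  exact congrArg (fun u : Linf d E => u n) h

theorem memSeq_toLinf (q : Exponent) (f : SeqSpace d E q) : MemSeq q (fun n => toLinf q f n) :=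
  memSeq_coe q f

/-- A bounded sequence that belongs to `ℓ^q` (or `𝔠₀`), as an element of that space. -/
def ofLinf (q : Exponent) (f : Linf d E) (h : MemSeq q (fun n => f n)) : SeqSpace d E q :=
  ⟨⟨fun n => f n, h.1⟩, h.2⟩

@[simp] theorem toLinf_ofLinf (q : Exponent) (f : Linf d E) (h : MemSeq q (fun n => f n)) :
    toLinf q (ofLinf q f h) = f := rfl

theorem isClosed_seqSpace (q : Exponent) :
    IsClosed (SeqSpace d E q : Set (lp (fun _ : Idx d => E) q.normExp)) := by
  by_cases h : q.1 = 0
  · have hcont : Continuous fun f : lp (fun _ : Idx d => E) q.normExp =>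
        (⟨fun n => f n, (lp.memℓp f).of_exponent_ge le_top⟩ : Linf d E) := by
      let L : lp (fun _ : Idx d => E) q.normExp →ₗ[ℂ] Linf d E :=
        { toFun := fun f => ⟨fun n => f n, (lp.memℓp f).of_exponent_ge le_top⟩
          map_add' := fun _ _ => rfl
          map_smul' := fun _ _ => rfl }
      exact (L.mkContinuous 1 fun f => by
        rw [one_mul]
        exact lp.norm_le_of_forall_le (norm_nonneg f)
          fun n => lp.norm_apply_le_norm q.normExp_ne_zero f n).continuous
    convert isClosed_null.preimage hcont using 1
    ext f
    exact ⟨fun hf => hf h, fun hf _ => hf⟩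
  · convert isClosed_univ
    ext f
    exact ⟨fun _ => trivial, fun _ h' => absurd h' h⟩

instance [CompleteSpace E] (q : Exponent) : CompleteSpace (SeqSpace d E q) :=
  (isClosed_seqSpace q).completeSpace_coe

/-- A bounded operator between `ℓ^∞` spaces that maps `𝔠₀` into `𝔠₀` and each `ℓ^q` into `ℓ^q`. -/
def Preserves (U : Linf d E →L[ℂ] Linf d F) : Prop :=
  ∀ (q : Exponent) (f : Linf d E), MemSeq q (fun n => f n) → MemSeq q (fun n => U f n)

theorem Preserves.comp {U : Linf d F →L[ℂ] Linf d G} {V : Linf d E →L[ℂ] Linf d F}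
    (hU : Preserves U) (hV : Preserves V) : Preserves (U ∘L V) :=
  fun q f hf => hU q _ (hV q f hf)

theorem Preserves.memℓp_one {U : Linf d E →L[ℂ] Linf d F} (hU : Preserves U) {f : Linf d E}
    (hf : Memℓp (fun n => f n) 1) : Memℓp (fun n => U f n) 1 :=
  memSeq_one_iff.1 (hU _ f (memSeq_one_iff.2 hf))

/-- The restriction of a space-preserving operator to `ℓ^q` (or `𝔠₀`). It is bounded by the closed
graph theorem. -/
noncomputable def seqMap [CompleteSpace E] [CompleteSpace F] (U : Linf d E →L[ℂ] Linf d F)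
    (hU : Preserves U) (q : Exponent) : SeqSpace d E q →L[ℂ] SeqSpace d F q :=
  let L : SeqSpace d E q →ₗ[ℂ] SeqSpace d F q :=
    { toFun := fun f => ofLinf q (U (toLinf q f)) (hU q _ (memSeq_toLinf q f))
      map_add' := fun f g => toLinf_injective q (by simp)
      map_smul' := fun c f => toLinf_injective q (by simp) }
  ⟨L, by
    refine L.continuous_of_seq_closed_graph fun u x y hu hy => ?_
    apply toLinf_injective q
    have h1 := ((toLinf q).continuous.tendsto _).comp hy
    have h2 := ((U.comp (toLinf q)).continuous.tendsto _).comp hu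
    exact tendsto_nhds_unique h1 h2⟩

@[simp] theorem toLinf_seqMap [CompleteSpace E] [CompleteSpace F] (U : Linf d E →L[ℂ] Linf d F)
    (hU : Preserves U) (q : Exponent) (f : SeqSpace d E q) :
    toLinf q (seqMap U hU q f) = U (toLinf q f) := rfl

/-! ### Unit sequences -/

/-- A finitely nonzero sequence, as an element of `ℓ^q` or `𝔠₀`. -/
noncomputable def seqSingle (q : Exponent) (n : Idx d) (h : E) : SeqSpace d E q :=
  ofLinf q (lp.single ∞ n h) (memSeq_of_memℓp_one q (memℓp_one_single n h))

@[simp] theorem toLinf_seqSingle (q : Exponent) (n : Idx d) (h : E) :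
    toLinf q (seqSingle q n h) = lp.single ∞ n h := rfl

theorem hasSum_seqSingle {q : Exponent} (hq : q.1 ≠ ∞) (f : SeqSpace d E q) :
    HasSum (fun n => seqSingle q n (f.1 n)) f := by
  by_cases h0 : q.1 = 0
  · have hiso : ∀ g : SeqSpace d E q, ‖g‖ ≤ ‖toLinf q g‖ := fun g =>
      (SeqSpace.norm_le_iff_top (Or.inl h0) g (norm_nonneg _)).2
        fun n => lp.norm_apply_le_norm (by simp) (toLinf q g) n
    have h1 := hasSum_null (f := toLinf q f) (f.2 h0)
    rw [HasSum, tendsto_iff_norm_sub_tendsto_zero] at h1 ⊢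
    refine squeeze_zero (fun _ => norm_nonneg _) (fun s => ?_) h1
    refine (hiso _).trans_eq ?_
    rw [map_sub, map_sum]
    rfl
  · have hqq : q.normExp ≠ ∞ := by simpa [Exponent.normExp, h0] using hq
    have h1 := lp.hasSum_single hqq f.1
    rw [HasSum, tendsto_iff_norm_sub_tendsto_zero] at h1 ⊢
    refine h1.congr fun s => ?_
    have h2 : ∀ n, (seqSingle q n (f.1 n)).1 = lp.single q.normExp n (f.1 n) :=
      fun n => lp.ext rfl
    change _ = ‖(∑ b ∈ s, seqSingle q b (f.1 b) - f).1‖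
    rw [Submodule.coe_sub, Submodule.coe_sum]
    simp only [h2]

theorem norm_seqSingle (q : Exponent) (n : Idx d) (h : E) : ‖seqSingle q n h‖ = ‖h‖ := by
  have h1 : (seqSingle q n h).1 = lp.single q.normExp n h := lp.ext rfl
  change ‖(seqSingle q n h).1‖ = _
  have h2 : ‖(lp.single q.normExp n h : lp (fun _ : Idx d => E) q.normExp)‖ = ‖h‖ :=
    lp.norm_single (E := fun _ : Idx d => E) (zero_lt_one.trans_le q.one_le_normExp) n h
  rw [h1, h2]

theorem SeqSpace.norm_le_of_hasSum {q : Exponent} (f : SeqSpace d E q) {S : ℝ}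
    (h : HasSum (fun n => ‖f.1 n‖) S) : ‖f‖ ≤ S := by
  by_cases hq : q.1 = ∞
  · rw [SeqSpace.norm_le_iff_top (Or.inr hq) f (h.nonneg fun _ => norm_nonneg _)]
    exact fun n => le_hasSum h n fun _ _ => norm_nonneg _
  · rw [← (hasSum_seqSingle hq f).tsum_eq]
    exact tsum_of_norm_bounded h fun n => (norm_seqSingle q n _).le

/-- An operator that maps the unit sequences into `𝔠₀` maps `𝔠₀` into `𝔠₀`, because the unit
sequences span a dense subspace of `𝔠₀`. -/
theorem null_of_single {U : Linf d E →L[ℂ] Linf d F}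
    (hU : ∀ n h, Tendsto (fun m => U (lp.single ∞ n h) m) cofinite (𝓝 0)) {f : Linf d E}
    (hf : Tendsto (fun n => f n) cofinite (𝓝 0)) :
    Tendsto (fun n => U f n) cofinite (𝓝 0) := by
  have h := (hasSum_null hf).mapL U
  refine isClosed_null.mem_of_tendsto h (Eventually.of_forall fun s => ?_)
  rw [Set.mem_ofPred_eq]
  have : ∀ n, (∑ i ∈ s, U (lp.single ∞ i (f i))) n = ∑ i ∈ s, U (lp.single ∞ i (f i)) n := by
    intro n
    rw [lp.coeFn_sum, Finset.sum_apply]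
  simp only [this]
  simpa using tendsto_finsetSum s fun i _ => hU i (f i)

/-- Two operators that agree on the unit sequences agree on `𝔠₀`. -/
theorem eq_of_null {U V : Linf d E →L[ℂ] Linf d F}
    (hU : ∀ n h, U (lp.single ∞ n h) = V (lp.single ∞ n h)) {f : Linf d E}
    (hf : Tendsto (fun n => f n) cofinite (𝓝 0)) : U f = V f := by
  have h1 := (hasSum_null hf).mapL U
  have h2 := (hasSum_null hf).mapL V
  simp only [hU] at h1
  exact h1.unique h2

/-- It suffices to check `Preserves` for the finite exponents. -/
theorem preserves_of_summable {U : Linf d E →L[ℂ] Linf d F}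
    (h : ∀ (q : ℝ), 1 ≤ q → ∀ f : Linf d E, Summable (fun n => ‖f n‖ ^ q) →
      Summable (fun n => ‖U f n‖ ^ q)) : Preserves U := by
  have key : ∀ q : Exponent, q.1 ≠ 0 → q.1 ≠ ∞ → ∀ f : Linf d E, MemSeq q (fun n => f n) →
      MemSeq q (fun n => U f n) := fun q h0 ht f hf =>
    (memSeq_iff_summable h0 ht).2 (h _ (Exponent.one_le_toReal h0 ht) f
      ((memSeq_iff_summable h0 ht).1 hf))
  intro q f hf
  by_cases h0 : q.1 = 0
  · obtain rfl : q = ⟨0, Or.inl rfl⟩ := Subtype.ext h0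
    rw [memSeq_zero_iff (lp.memℓp _)] at hf ⊢
    refine null_of_single (fun n x => ?_) hf
    have h1 := key ⟨1, Or.inr le_rfl⟩ (by simp) (by simp) _
      (memSeq_one_iff.2 (memℓp_one_single n x))
    exact (memSeq_of_memℓp_one ⟨0, Or.inl rfl⟩ (memSeq_one_iff.1 h1)).2 rfl
  · by_cases ht : q.1 = ∞
    · obtain rfl : q = ⟨∞, Or.inr le_top⟩ := Subtype.ext ht
      exact memSeq_top _
    · exact key q h0 ht f hf

end Spaces

/-! ### The sesquilinear pairing and adjoint operators -/

section Pairing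

variable {d : ℕ} {E F G : Type*} [NormedAddCommGroup E] [InnerProductSpace ℂ E]
  [NormedAddCommGroup F] [InnerProductSpace ℂ F] [NormedAddCommGroup G] [InnerProductSpace ℂ G]

theorem conj_pairing (f g : Idx d → E) : starRingEnd ℂ (pairing f g) = pairing g f := by
  simp only [pairing, Complex.conj_tsum, inner_conj_symm]

theorem pairing_single_right (f : Idx d → E) (n : Idx d) (h : E) :
    pairing f (fun m => (lp.single ∞ n h : Linf d E) m) = inner ℂ h (f n) := by
  unfold pairing
  rw [tsum_eq_single n]
  · simp
  · intro m hm
    simp [lp.single_apply, hm]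

theorem pairing_single_left (g : Idx d → E) (n : Idx d) (h : E) :
    pairing (fun m => (lp.single ∞ n h : Linf d E) m) g = inner ℂ (g n) h := by
  rw [← conj_pairing, pairing_single_right, inner_conj_symm]

theorem summable_inner {f g : Idx d → E} (hf : Memℓp f ∞) (hg : Memℓp g 1) :
    Summable fun m => inner ℂ (g m) (f m) := by
  have hg' : Summable fun m => ‖g m‖ := by
    simpa using (memℓp_gen_iff (p := 1) (by simp)).1 hg
  refine Summable.of_norm_bounded (hg'.mul_right ‖(⟨f, hf⟩ : Linf d E)‖) fun m => ?_
  exact (norm_inner_le_norm _ _).trans (mul_le_mul_of_nonneg_left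
    (lp.norm_apply_le_norm (by simp) (⟨f, hf⟩ : Linf d E) m) (norm_nonneg _))

/-- The bounded functional `f ↦ ⟨f, g⟩` on `ℓ^1` given by a bounded sequence `g`. -/
noncomputable def pairingL1 (g : Linf d E) :
    SeqSpace d E ⟨1, Or.inr le_rfl⟩ →L[ℂ] ℂ :=
  LinearMap.mkContinuous
    { toFun := fun f => pairing (fun m => f.1 m) (fun m => g m)
      map_add' := fun f f' => by
        have hs : ∀ f : SeqSpace d E ⟨1, Or.inr le_rfl⟩,
            Summable fun m => inner ℂ (g m) (f.1 m) := fun f => by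
          have := (summable_inner (lp.memℓp g) (memSeq_one_iff.1 (memSeq_coe _ f))).star
          simpa using this
        simp only [pairing]
        rw [← (hs f).tsum_add (hs f')]
        exact tsum_congr fun m => inner_add_right _ _ _
      map_smul' := fun c f => by
        simp only [pairing, RingHom.id_apply, smul_eq_mul]
        rw [← tsum_mul_left]
        exact tsum_congr fun m => inner_smul_right _ _ _ }
    ‖g‖ (fun f => by
      have h := SeqSpace.hasSum_norm (by simp) (by simp) f
      simp only [ENNReal.toReal_one, Real.rpow_one] at h
      refine tsum_of_norm_bounded (h.mul_left ‖g‖) fun m => ?_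
      exact (norm_inner_le_norm _ _).trans
        (mul_le_mul_of_nonneg_right (lp.norm_apply_le_norm (by simp) g m) (norm_nonneg _)))

theorem norm_pairingL1_le (g : Linf d E) : ‖pairingL1 g‖ ≤ ‖g‖ :=
  LinearMap.mkContinuous_norm_le _ (norm_nonneg g) _

/-- Hölder's inequality for the pairing. -/
theorem norm_pairing_le {p q : ℝ} (hpq : p.HolderConjugate q) {f g : Idx d → E}
    (hf : Summable fun m => ‖f m‖ ^ p) (hg : Summable fun m => ‖g m‖ ^ q) :
    ‖pairing f g‖ ≤ (∑' m, ‖f m‖ ^ p) ^ (1 / p) * (∑' m, ‖g m‖ ^ q) ^ (1 / q) := by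
  have h := Real.summable_and_inner_le_Lp_mul_Lq_tsum_of_nonneg hpq (fun m => norm_nonneg (f m))
    (fun m => norm_nonneg (g m)) hf hg
  refine le_trans (tsum_of_norm_bounded h.1.hasSum fun m => ?_) h.2
  rw [mul_comm]
  exact norm_inner_le_norm _ _

/-- `U` and `V` are formal adjoints of each other: both respect all the sequence spaces, and
`⟨Uf, g⟩ = ⟨f, Vg⟩` whenever one of `f`, `g` is in `ℓ^1` and the other one is bounded. -/
structure IsAdj (U : Linf d E →L[ℂ] Linf d F) (V : Linf d F →L[ℂ] Linf d E) : Prop where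
  left : Preserves U
  right : Preserves V
  pairing_of_left : ∀ f g, Memℓp (fun m => f m) 1 →
    pairing (fun m => U f m) (fun m => g m) = pairing (fun m => f m) (fun m => V g m)
  pairing_of_right : ∀ f g, Memℓp (fun m => g m) 1 →
    pairing (fun m => U f m) (fun m => g m) = pairing (fun m => f m) (fun m => V g m)

theorem IsAdj.symm {U : Linf d E →L[ℂ] Linf d F} {V : Linf d F →L[ℂ] Linf d E}
    (h : IsAdj U V) : IsAdj V U where
  left := h.right
  right := h.left
  pairing_of_left f g hf := by
    rw [← conj_pairing, ← h.pairing_of_right g f hf, conj_pairing]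
  pairing_of_right f g hg := by
    rw [← conj_pairing, ← h.pairing_of_left g f hg, conj_pairing]

theorem IsAdj.comp {U : Linf d F →L[ℂ] Linf d G} {V : Linf d G →L[ℂ] Linf d F}
    {U' : Linf d E →L[ℂ] Linf d F} {V' : Linf d F →L[ℂ] Linf d E}
    (h : IsAdj U V) (h' : IsAdj U' V') : IsAdj (U ∘L U') (V' ∘L V) where
  left := h.left.comp h'.left
  right := h'.right.comp h.right
  pairing_of_left f g hf := by
    rw [ContinuousLinearMap.comp_apply, h.pairing_of_left _ _ (h'.left.memℓp_one hf),
      h'.pairing_of_left _ _ hf]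
    rfl
  pairing_of_right f g hg := by
    rw [ContinuousLinearMap.comp_apply, h.pairing_of_right _ _ hg,
      h'.pairing_of_right _ _ (h.right.memℓp_one hg)]
    rfl

theorem linf_ext_inner {f g : Linf d E}
    (h : ∀ n x, pairing (fun m => f m) (fun m => (lp.single ∞ n x : Linf d E) m) =
      pairing (fun m => g m) (fun m => (lp.single ∞ n x : Linf d E) m)) : f = g := by
  refine lp.ext (funext fun n => ext_inner_left ℂ fun x => ?_)
  simpa only [pairing_single_right] using h n x

theorem IsAdj.right_eq_of_single {U U' : Linf d E →L[ℂ] Linf d F}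
    {V V' : Linf d F →L[ℂ] Linf d E} (h : IsAdj U V) (h' : IsAdj U' V')
    (hs : ∀ n x, U (lp.single ∞ n x) = U' (lp.single ∞ n x)) : V = V' := by
  ext1 g
  refine lp.ext (funext fun n => ext_inner_right ℂ fun x => ?_)
  rw [← pairing_single_left (fun m => V g m), ← pairing_single_left (fun m => V' g m),
    ← h.pairing_of_left _ _ (memℓp_one_single n x),
    ← h'.pairing_of_left _ _ (memℓp_one_single n x), hs]

/-- Weak* continuity in coordinates: an operator with a formal adjoint is determined by its values
on the unit sequences, even on `ℓ^∞`. -/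
theorem IsAdj.eq_of_single {U U' : Linf d E →L[ℂ] Linf d F} {V V' : Linf d F →L[ℂ] Linf d E}
    (h : IsAdj U V) (h' : IsAdj U' V')
    (hs : ∀ n x, U (lp.single ∞ n x) = U' (lp.single ∞ n x)) : U = U' := by
  ext1 f
  refine linf_ext_inner fun n x => ?_
  rw [h.pairing_of_right _ _ (memℓp_one_single n x),
    h'.pairing_of_right _ _ (memℓp_one_single n x), h.right_eq_of_single h' hs]

theorem IsAdj.id : IsAdj (ContinuousLinearMap.id ℂ (Linf d E)) (ContinuousLinearMap.id ℂ _) :=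
  ⟨fun _ _ h => h, fun _ _ h => h, fun _ _ _ => rfl, fun _ _ _ => rfl⟩

/-- A space-preserving right inverse of a formally self-adjoint operator is formally
self-adjoint. -/
theorem IsAdj.inverse {S R : Linf d E →L[ℂ] Linf d E} (h : IsAdj S S) (hR : Preserves R)
    (hSR : ∀ f, S (R f) = f) : IsAdj R R where
  left := hR
  right := hR
  pairing_of_left f g hf := by
    nth_rewrite 1 [← hSR g]
    rw [← h.pairing_of_left _ _ (hR.memℓp_one hf), hSR]
  pairing_of_right f g hg := by
    nth_rewrite 1 [← hSR g]
    rw [← h.pairing_of_right _ _ (hR.memℓp_one hg), hSR]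

end Pairing

section Adjoint

variable {d : ℕ} {E F : Type*} [NormedAddCommGroup E] [InnerProductSpace ℂ E] [CompleteSpace E]
  [NormedAddCommGroup F] [InnerProductSpace ℂ F] [CompleteSpace F]

/-- The functional `h ↦ ⟨U(h e_m), g⟩` on `E`. -/
noncomputable def coordFunctional (U : Linf d E →L[ℂ] Linf d F) (hU : Preserves U) (m : Idx d)
    (g : Linf d F) : StrongDual ℂ E :=
  LinearMap.mkContinuous
    { toFun := fun h => pairingL1 g (seqMap U hU _ (seqSingle _ m h))
      map_add' := fun x y => by
        rw [← map_add, ← map_add]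
        congr 2
        exact toLinf_injective _ (by simp [lp.single_add])
      map_smul' := fun c x => by
        rw [RingHom.id_apply, ← map_smul, ← map_smul]
        congr 2
        exact toLinf_injective _ (by simp [lp.single_smul]) }
    (‖g‖ * ‖seqMap U hU ⟨1, Or.inr le_rfl⟩‖) (fun h => by
      rw [mul_assoc]
      refine ((pairingL1 g).le_opNorm _).trans ?_
      refine mul_le_mul (norm_pairingL1_le g) ?_ (norm_nonneg _) (norm_nonneg _)
      refine ((seqMap U hU _).le_opNorm _).trans_eq ?_
      rw [norm_seqSingle])

theorem coordFunctional_apply (U : Linf d E →L[ℂ] Linf d F) (hU : Preserves U) (m : Idx d)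
    (g : Linf d F) (h : E) : coordFunctional U hU m g h =
      pairing (fun n => U (lp.single ∞ m h) n) (fun n => g n) := rfl

theorem norm_coordFunctional_le (U : Linf d E →L[ℂ] Linf d F) (hU : Preserves U) (m : Idx d)
    (g : Linf d F) :
    ‖coordFunctional U hU m g‖ ≤ ‖seqMap U hU ⟨1, Or.inr le_rfl⟩‖ * ‖g‖ := by
  rw [mul_comm]
  exact LinearMap.mkContinuous_norm_le _ (by positivity) _

/-- The adjoint on `ℓ^∞` of the restriction of `U` to `ℓ^1`, built coordinatewise with the Riesz
representation theorem. -/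
noncomputable def adjOp (U : Linf d E →L[ℂ] Linf d F) (hU : Preserves U) :
    Linf d F →L[ℂ] Linf d E :=
  have hb : ∀ g m, ‖(InnerProductSpace.toDual ℂ E).symm (coordFunctional U hU m g)‖ ≤
      ‖seqMap U hU ⟨1, Or.inr le_rfl⟩‖ * ‖g‖ := fun g m => by
    rw [LinearIsometryEquiv.norm_map]
    exact norm_coordFunctional_le U hU m g
  LinearMap.mkContinuous
    { toFun := fun g => (⟨fun m => (InnerProductSpace.toDual ℂ E).symm (coordFunctional U hU m g),
        memℓp_infty ⟨_, by rintro _ ⟨m, rfl⟩; exact hb g m⟩⟩ : Linf d E)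
      map_add' := fun g g' => by
        refine lp.ext (funext fun m => ?_)
        change _ = (InnerProductSpace.toDual ℂ E).symm _ + (InnerProductSpace.toDual ℂ E).symm _
        rw [← map_add]
        change (InnerProductSpace.toDual ℂ E).symm _ = _
        congr 1
        ext h
        rw [add_apply]
        simp only [coordFunctional_apply]
        rw [← conj_pairing, ← conj_pairing fun n => g n, ← conj_pairing fun n => g' n]
        rw [← map_add]
        congr 1
        simp only [pairing]
        have h1 := hU.memℓp_one (memℓp_one_single m h)
        rw [← (summable_inner (lp.memℓp g) h1).tsum_add (summable_inner (lp.memℓp g') h1)]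
        exact tsum_congr fun m => inner_add_right _ _ _
      map_smul' := fun c g => by
        refine lp.ext (funext fun m => ?_)
        change _ = c • (InnerProductSpace.toDual ℂ E).symm _
        change (InnerProductSpace.toDual ℂ E).symm _ = _
        rw [LinearIsometryEquiv.symm_apply_eq, map_smulₛₗ, LinearIsometryEquiv.apply_symm_apply]
        ext h
        simp only [smul_apply, coordFunctional_apply, pairing, smul_eq_mul]
        rw [← tsum_mul_left]
        exact tsum_congr fun m => inner_smul_left _ _ _ }
    ‖seqMap U hU ⟨1, Or.inr le_rfl⟩‖ (fun g => by
      exact lp.norm_le_of_forall_le (by positivity) (hb g))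

theorem inner_adjOp (U : Linf d E →L[ℂ] Linf d F) (hU : Preserves U) (g : Linf d F) (m : Idx d)
    (h : E) : inner ℂ (adjOp U hU g m) h =
      pairing (fun n => U (lp.single ∞ m h) n) (fun n => g n) :=
  InnerProductSpace.toDual_symm_apply

theorem pairing_adjOp (U : Linf d E →L[ℂ] Linf d F) (hU : Preserves U) (f : Linf d E)
    (g : Linf d F) (hf : Memℓp (fun m => f m) 1) :
    pairing (fun m => U f m) (fun m => g m) =
      pairing (fun m => f m) (fun m => adjOp U hU g m) := by
  let f1 := ofLinf ⟨1, Or.inr le_rfl⟩ f (memSeq_one_iff.2 hf)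
  have hs := hasSum_seqSingle (by simp) f1
  have h1 := hs.mapL (pairingL1 g ∘L seqMap U hU ⟨1, Or.inr le_rfl⟩)
  have h2 := hs.mapL (pairingL1 (adjOp U hU g))
  have h3 : ∀ n, (pairingL1 g ∘L seqMap U hU ⟨1, Or.inr le_rfl⟩) (seqSingle _ n (f1.1 n)) =
      pairingL1 (adjOp U hU g) (seqSingle _ n (f1.1 n)) := fun n => by
    refine (inner_adjOp U hU g n (f n)).symm.trans ?_
    exact (pairing_single_left _ n (f n)).symm
  simp only [h3] at h1
  exact h1.unique h2

/-- Boundedness of the adjoint on `ℓ^q` for `1 < q < ∞`: testing `v = U^* g` against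
`‖v_m‖^(q-2) v_m` on finite sets of indices, with Hölder's inequality for the conjugate exponent. -/
theorem summable_adjOp (U : Linf d E →L[ℂ] Linf d F) (hU : Preserves U) {q : ℝ} (hq : 1 < q)
    (g : Linf d F) (hg : Summable fun n => ‖g n‖ ^ q) :
    Summable fun n => ‖adjOp U hU g n‖ ^ q := by
  have hpq : (q / (q - 1)).HolderConjugate q := (Real.HolderConjugate.conjExponent hq).symm
  set p := q / (q - 1) with hp
  have hp1 : 1 ≤ p := hpq.lt.le
  have hp0 : 0 < p := hpq.pos
  let P : Exponent := ⟨ENNReal.ofReal p, Or.inr (by simpa using hp1)⟩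
  have hP0 : P.1 ≠ 0 := by simpa [P] using hp0
  have hPt : P.1 ≠ ∞ := by simp [P]
  have hPr : P.1.toReal = p := ENNReal.toReal_ofReal hp0.le
  set v := adjOp U hU g with hv
  set C := ‖seqMap U hU P‖ * (∑' m, ‖g m‖ ^ q) ^ (1 / q) with hC
  have hC0 : 0 ≤ C := by positivity
  refine summable_of_sum_le (c := C ^ q) (fun n => by positivity) fun s => ?_
  set S := ∑ n ∈ s, ‖v n‖ ^ q with hS
  have hS0 : 0 ≤ S := by positivity
  let F1 : SeqSpace d E P := ∑ n ∈ s, seqSingle P n ((‖v n‖ ^ (q - 2) : ℝ) • v n)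
  have hF1 : ∀ n, F1.1 n = if n ∈ s then (‖v n‖ ^ (q - 2) : ℝ) • v n else 0 := fun n => by
    rw [← toLinf_apply, map_sum, lp.coeFn_sum, Finset.sum_apply]
    simp [lp.single_apply, Pi.single_apply]
  have hpow : ∀ n, ‖(‖v n‖ ^ (q - 2) : ℝ) • v n‖ = ‖v n‖ ^ (q - 1) := fun n => by
    rw [norm_smul, Real.norm_of_nonneg (by positivity)]
    rcases eq_or_ne (v n) 0 with h | h
    · simp [h, Real.zero_rpow (sub_pos.2 hq).ne']
    · rw [← Real.rpow_add_one (norm_ne_zero_iff.2 h)]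
      congr 1; ring
  have hnF : ‖F1‖ = S ^ (1 / p) := by
    have h1 := SeqSpace.hasSum_norm hP0 hPt F1
    rw [hPr] at h1
    have h2 : HasSum (fun n => ‖F1.1 n‖ ^ p) S := by
      rw [hS]
      have : ∀ n, ‖F1.1 n‖ ^ p = if n ∈ s then ‖v n‖ ^ q else 0 := fun n => by
        rw [hF1]
        split_ifs
        · rw [hpow, ← Real.rpow_mul (norm_nonneg _)]
          congr 1
          rw [hp]; field_simp [(sub_pos.2 hq).ne']
        · simp [hp0.ne']
      simp only [this]
      have h2 : HasSum (fun n => if n ∈ s then ‖v n‖ ^ q else 0)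
          (∑ n ∈ s, if n ∈ s then ‖v n‖ ^ q else 0) :=
        hasSum_sum_of_ne_finset_zero fun n hn => by simp [hn]
      rwa [Finset.sum_congr rfl fun n hn => if_pos hn] at h2
    rw [← h1.unique h2, ← Real.rpow_mul (norm_nonneg _), mul_one_div_cancel hp0.ne', Real.rpow_one]
  have hSle : S ≤ C * S ^ (1 / p) := by
    have hfin : Memℓp (fun m => toLinf P F1 m) 1 := by
      have : ∀ t : Finset (Idx d), Memℓp (fun m => (∑ n ∈ t, (lp.single ∞ n
          ((‖v n‖ ^ (q - 2) : ℝ) • v n) : Linf d E)) m) 1 := fun t => by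
        have := Memℓp.finsetSum t (p := 1) (f := fun n m => (lp.single ∞ n
          ((‖v n‖ ^ (q - 2) : ℝ) • v n) : Linf d E) m) fun n _ => memℓp_one_single n _
        convert this using 2 with m
        rw [lp.coeFn_sum, Finset.sum_apply]
      convert this s using 2
      rw [map_sum]; rfl
    have h1 := pairing_adjOp U hU (toLinf P F1) g hfin
    have h2 : pairing (fun m => toLinf P F1 m) (fun m => v m) = (S : ℂ) := by
      simp only [pairing, toLinf_apply, hF1]
      rw [tsum_eq_sum (s := s) (fun n hn => by simp [hn]), hS, Complex.ofReal_sum]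
      refine Finset.sum_congr rfl fun n hn => ?_
      rw [if_pos hn, inner_smul_right_eq_smul, inner_self_eq_norm_sq_to_K]
      rcases eq_or_ne (v n) 0 with h | h
      · simp [h, (zero_lt_one.trans hq).ne']
      · rw [Complex.real_smul, show q = q - 2 + (2 : ℕ) by push_cast; ring,
          Real.rpow_add_natCast (norm_ne_zero_iff.2 h)]
        simp
    have h3 := SeqSpace.hasSum_norm hP0 hPt (seqMap U hU P F1)
    rw [hPr] at h3
    have h4 := norm_pairing_le hpq (f := fun m => U (toLinf P F1) m) (g := fun m => g m)
      h3.summable hg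
    have h5 : (∑' m, ‖U (toLinf P F1) m‖ ^ p) ^ (1 / p) = ‖seqMap U hU P F1‖ := by
      have := h3.tsum_eq
      change (∑' m, ‖U (toLinf P F1) m‖ ^ p) = _ at this
      rw [this, ← Real.rpow_mul (norm_nonneg _), mul_one_div_cancel hp0.ne', Real.rpow_one]
    rw [h1, ← hv, h2, Complex.norm_of_nonneg hS0, h5] at h4
    refine h4.trans ?_
    rw [hC, ← hnF, mul_right_comm]
    exact mul_le_mul_of_nonneg_right ((seqMap U hU P).le_opNorm _) (by positivity)
  rcases hS0.eq_or_lt with h | h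
  · rw [← h]; positivity
  · have h1 : S ^ (1 / q) ≤ C := by
      have h2 : S = S ^ (1 / q) * S ^ (1 / p) := by
        rw [← Real.rpow_add h, one_div, one_div, add_comm, hpq.inv_add_inv_eq_one, Real.rpow_one]
      have h3 : 0 < S ^ (1 / p) := Real.rpow_pos_of_pos h _
      nth_rewrite 1 [h2] at hSle
      exact le_of_mul_le_mul_right hSle h3
    have hq0 : 0 < q := zero_lt_one.trans hq
    calc S = (S ^ (1 / q)) ^ q := by
          rw [← Real.rpow_mul hS0, one_div_mul_cancel hq0.ne', Real.rpow_one]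
      _ ≤ C ^ q := Real.rpow_le_rpow (by positivity) h1 hq0.le

/-- The adjoint maps `ℓ^1` into `ℓ^1`: on a finite set of indices, `∑ ‖(U^* g)_m‖` is the pairing of
`U^* g` with a sequence of norm at most one in `ℓ^∞`. -/
theorem summable_adjOp_one (U : Linf d E →L[ℂ] Linf d F) (hU : Preserves U)
    (g : Linf d F) (hg : Summable fun n => ‖g n‖) :
    Summable fun n => ‖adjOp U hU g n‖ := by
  set v := adjOp U hU g with hv
  refine summable_of_sum_le (c := ‖U‖ * ∑' n, ‖g n‖) (fun n => norm_nonneg _) fun s => ?_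
  let F1 : Linf d E := ∑ n ∈ s, lp.single ∞ n ((‖v n‖⁻¹ : ℝ) • v n)
  have hF1 : ∀ n, F1 n = if n ∈ s then (‖v n‖⁻¹ : ℝ) • v n else 0 := fun n => by
    rw [lp.coeFn_sum, Finset.sum_apply]
    simp [lp.single_apply, Pi.single_apply]
  have hnF : ‖F1‖ ≤ 1 := by
    refine lp.norm_le_of_forall_le zero_le_one fun n => ?_
    rw [hF1]
    split_ifs
    · rw [norm_smul, norm_inv, norm_norm]
      exact inv_mul_le_one
    · simp
  have hfin : Memℓp (fun m => F1 m) 1 := by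
    have := Memℓp.finsetSum s (p := 1) (f := fun n m => (lp.single ∞ n
      ((‖v n‖⁻¹ : ℝ) • v n) : Linf d E) m) fun n _ => memℓp_one_single n _
    convert this using 2 with m
    rw [lp.coeFn_sum, Finset.sum_apply]
  have h1 := pairing_adjOp U hU F1 g hfin
  have h2 : pairing (fun m => F1 m) (fun m => v m) = ((∑ n ∈ s, ‖v n‖ : ℝ) : ℂ) := by
    simp only [pairing, hF1]
    rw [tsum_eq_sum (s := s) (fun n hn => by simp [hn]), Complex.ofReal_sum]
    refine Finset.sum_congr rfl fun n hn => ?_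
    rw [if_pos hn, inner_smul_right_eq_smul, inner_self_eq_norm_sq_to_K]
    rcases eq_or_ne (v n) 0 with h | h
    · simp [h]
    · have : (‖v n‖ : ℂ) ≠ 0 := by exact_mod_cast norm_ne_zero_iff.2 h
      rw [Complex.real_smul]
      simp only [Complex.ofReal_inv, Complex.coe_algebraMap]
      field_simp
  rw [← hv, h2] at h1
  have h3 : ‖((∑ n ∈ s, ‖v n‖ : ℝ) : ℂ)‖ ≤ ‖U‖ * ∑' n, ‖g n‖ := by
    rw [← h1]
    refine tsum_of_norm_bounded (hg.hasSum.mul_left ‖U‖) fun m => ?_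
    rw [mul_comm]
    refine (norm_inner_le_norm _ _).trans (mul_le_mul_of_nonneg_left ?_ (norm_nonneg _))
    refine (lp.norm_apply_le_norm (by simp) (U F1) m).trans ?_
    exact U.le_of_opNorm_le_of_le le_rfl hnF |>.trans_eq (mul_one _)
  rwa [Complex.norm_of_nonneg (by positivity)] at h3

theorem preserves_adjOp (U : Linf d E →L[ℂ] Linf d F) (hU : Preserves U) :
    Preserves (adjOp U hU) := by
  refine preserves_of_summable fun q hq g hg => ?_
  rcases hq.eq_or_lt with rfl | hq
  · simp only [Real.rpow_one] at hg ⊢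
    exact summable_adjOp_one U hU g hg
  · exact summable_adjOp U hU hq g hg

/-- The operator `U` restricted to `𝔠₀` has a weak* continuous extension to `ℓ^∞` (its biadjoint).
It need not be `U` itself. -/
theorem exists_isAdj (U : Linf d E →L[ℂ] Linf d F) (hU : Preserves U) :
    ∃ W, IsAdj W (adjOp U hU) ∧
      ∀ f : Linf d E, Tendsto (fun n => f n) cofinite (𝓝 0) → W f = U f := by
  set V := adjOp U hU with hV
  have hVp : Preserves V := preserves_adjOp U hU
  have hWs : ∀ n x, adjOp V hVp (lp.single ∞ n x) = U (lp.single ∞ n x) := fun n x => by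
    refine lp.ext (funext fun m => ext_inner_right ℂ fun y => ?_)
    rw [inner_adjOp, ← conj_pairing, ← pairing_adjOp U hU _ _ (memℓp_one_single n x),
      pairing_single_right, inner_conj_symm]
  have h0 : ∀ f : Linf d E, Tendsto (fun n => f n) cofinite (𝓝 0) → adjOp V hVp f = U f :=
    fun f hf => eq_of_null hWs hf
  refine ⟨adjOp V hVp, ⟨preserves_adjOp V hVp, hVp, fun f g hf => ?_, fun f g hg => ?_⟩, h0⟩
  · rw [h0 f ((memSeq_of_memℓp_one ⟨0, Or.inl rfl⟩ hf).2 rfl), pairing_adjOp U hU f g hf]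
  · rw [← conj_pairing, ← pairing_adjOp V hVp g f hg, conj_pairing]

end Adjoint

/-! ### The Schur test -/

/-- The kernel `k` has row sums and column sums at most `C`. -/
def SchurBound {ι κ : Type*} (k : ι → κ → ℝ≥0∞) (C : ℝ≥0∞) : Prop :=
  (∀ m, ∑' n, k m n ≤ C) ∧ ∀ n, ∑' m, k m n ≤ C

theorem SchurBound.mono {ι κ : Type*} {k l : ι → κ → ℝ≥0∞} {C : ℝ≥0∞} (h : SchurBound l C)
    (hkl : ∀ m n, k m n ≤ l m n) : SchurBound k C :=
  ⟨fun m => (ENNReal.tsum_le_tsum fun n => hkl m n).trans (h.1 m),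
    fun n => (ENNReal.tsum_le_tsum fun m => hkl m n).trans (h.2 n)⟩

theorem SchurBound.const_mul {ι κ : Type*} {k : ι → κ → ℝ≥0∞} {C : ℝ≥0∞} (h : SchurBound k C)
    (c : ℝ≥0∞) : SchurBound (fun m n => c * k m n) (c * C) :=
  ⟨fun m => by rw [ENNReal.tsum_mul_left]; exact mul_le_mul_right (h.1 m) c,
    fun n => by rw [ENNReal.tsum_mul_left]; exact mul_le_mul_right (h.2 n) c⟩

/-- The weighted power mean inequality for infinite sums. -/
theorem tsum_mul_rpow_le {ι : Type*} {p : ℝ} (hp : 1 ≤ p) (w u : ι → ℝ≥0∞) :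
    (∑' i, w i * u i) ^ p ≤ (∑' i, w i) ^ (p - 1) * ∑' i, w i * u i ^ p := by
  have hp0 : 0 < p := zero_lt_one.trans_le hp
  have h1 : ∑' i, w i * u i ≤ (∑' i, w i) ^ (1 - p⁻¹) * (∑' i, w i * u i ^ p) ^ p⁻¹ := by
    rw [ENNReal.tsum_eq_iSup_sum]
    refine iSup_le fun s => (ENNReal.inner_le_weight_mul_Lp_of_nonneg s hp w u).trans ?_
    have : 0 ≤ 1 - p⁻¹ := sub_nonneg.2 (inv_le_one_of_one_le₀ hp)
    gcongr
    · exact ENNReal.sum_le_tsum s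
    · exact ENNReal.sum_le_tsum s
  refine (ENNReal.rpow_le_rpow h1 hp0.le).trans_eq ?_
  rw [ENNReal.mul_rpow_of_nonneg _ _ hp0.le, ← ENNReal.rpow_mul, ← ENNReal.rpow_mul,
    inv_mul_cancel₀ hp0.ne', ENNReal.rpow_one, sub_mul, inv_mul_cancel₀ hp0.ne', one_mul]

theorem SchurBound.tsum_rpow_le {ι κ : Type*} {k : ι → κ → ℝ≥0∞} {C : ℝ≥0∞} (h : SchurBound k C)
    {p : ℝ} (hp : 1 ≤ p) (u : κ → ℝ≥0∞) :
    ∑' m, (∑' n, k m n * u n) ^ p ≤ C ^ p * ∑' n, u n ^ p := by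
  have hp1 : 0 ≤ p - 1 := sub_nonneg.2 hp
  calc ∑' m, (∑' n, k m n * u n) ^ p
      ≤ ∑' m, C ^ (p - 1) * ∑' n, k m n * u n ^ p := by
        refine ENNReal.tsum_le_tsum fun m => (tsum_mul_rpow_le hp _ _).trans ?_
        gcongr
        exact h.1 m
    _ = C ^ (p - 1) * ∑' n, (∑' m, k m n) * u n ^ p := by
        rw [ENNReal.tsum_mul_left, ENNReal.tsum_comm]
        simp only [ENNReal.tsum_mul_right]
    _ ≤ C ^ (p - 1) * ∑' n, C * u n ^ p := by
        gcongr with n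
        exact h.2 n
    _ = C ^ p * ∑' n, u n ^ p := by
        rw [ENNReal.tsum_mul_left, ← mul_assoc]
        congr 1
        nth_rewrite 2 [← ENNReal.rpow_one C]
        rw [← ENNReal.rpow_add_of_nonneg _ _ hp1 zero_le_one, sub_add_cancel]

theorem tsum_enorm_rpow {ι E : Type*} [NormedAddCommGroup E] {f : ι → E} {p : ℝ} (hp : 0 ≤ p) :
    ∑' n, ‖f n‖ₑ ^ p = ∑' n, ENNReal.ofReal (‖f n‖ ^ p) :=
  tsum_congr fun n => by
    rw [← ofReal_norm, ENNReal.ofReal_rpow_of_nonneg (norm_nonneg _) hp]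

theorem summable_rpow_iff {ι E : Type*} [NormedAddCommGroup E] {f : ι → E} {p : ℝ} (hp : 0 ≤ p) :
    Summable (fun n => ‖f n‖ ^ p) ↔ ∑' n, ‖f n‖ₑ ^ p ≠ ∞ := by
  rw [tsum_enorm_rpow hp]
  refine ⟨fun h => ?_, fun h => ?_⟩
  · rw [← ENNReal.ofReal_tsum_of_nonneg (fun n => by positivity) h]
    exact ENNReal.ofReal_ne_top
  · have := ENNReal.summable_toReal h
    refine this.congr fun n => ENNReal.toReal_ofReal (by positivity)

theorem summable_norm_iff_enorm {ι E : Type*} [NormedAddCommGroup E] {f : ι → E} :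
    Summable (fun n => ‖f n‖) ↔ ∑' n, ‖f n‖ₑ ≠ ∞ := by
  simpa using summable_rpow_iff (f := f) zero_le_one

theorem enorm_apply_le {d : ℕ} {E : Type*} [NormedAddCommGroup E] (f : Linf d E) (n : Idx d) :
    ‖f n‖ₑ ≤ ‖f‖ₑ := by
  rw [← ofReal_norm, ← ofReal_norm]
  exact ENNReal.ofReal_le_ofReal (lp.norm_apply_le_norm (by simp) f n)

section Schur

variable {d : ℕ} {E F G : Type*} [NormedAddCommGroup E] [NormedSpace ℂ E]
  [NormedAddCommGroup F] [NormedSpace ℂ F] [NormedAddCommGroup G] [NormedSpace ℂ G]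

theorem tsum_enorm_seqSpace {q : Exponent} (h0 : q.1 ≠ 0) (ht : q.1 ≠ ∞) (f : SeqSpace d E q) :
    ∑' n, ‖f.1 n‖ₑ ^ q.1.toReal = ENNReal.ofReal ‖f‖ ^ q.1.toReal := by
  have hs := SeqSpace.hasSum_norm h0 ht f
  have hp := ENNReal.toReal_nonneg (a := q.1)
  rw [tsum_enorm_rpow hp, ← ENNReal.ofReal_tsum_of_nonneg (fun n => by positivity)
    hs.summable, hs.tsum_eq, ENNReal.ofReal_rpow_of_nonneg (norm_nonneg _) hp]

/-- A sequence dominated by a Schur kernel applied to `f` has norm at most `C ‖f‖`, in each of the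
spaces `ℓ^q` and in `𝔠₀`. -/
theorem SchurBound.norm_le {k : Idx d → Idx d → ℝ≥0∞} {C : ℝ} (hC : 0 ≤ C)
    (h : SchurBound k (ENNReal.ofReal C)) {q : Exponent} (f : SeqSpace d E q) (g : SeqSpace d F q)
    (hg : ∀ m, ‖g.1 m‖ₑ ≤ ∑' n, k m n * ‖f.1 n‖ₑ) : ‖g‖ ≤ C * ‖f‖ := by
  by_cases hq : q.1 = 0 ∨ q.1 = ∞
  · refine (SeqSpace.norm_le_iff_top hq g (by positivity)).2 fun m => ?_
    rw [← ENNReal.ofReal_le_ofReal_iff (by positivity), ofReal_norm, ENNReal.ofReal_mul hC]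
    calc ‖g.1 m‖ₑ ≤ ∑' n, k m n * ENNReal.ofReal ‖f‖ := (hg m).trans
          (ENNReal.tsum_le_tsum fun n => mul_le_mul_right (by
            rw [← ofReal_norm]
            exact ENNReal.ofReal_le_ofReal
              (lp.norm_apply_le_norm q.normExp_ne_zero f.1 n)) _)
      _ ≤ _ := by
          rw [ENNReal.tsum_mul_right]
          exact mul_le_mul_left (h.1 m) _
  · obtain ⟨h0, ht⟩ := not_or.1 hq
    have hp := Exponent.one_le_toReal h0 ht
    set p := q.1.toReal with hpdef
    have hp0 : 0 < p := zero_lt_one.trans_le hp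
    have h1 : ENNReal.ofReal ‖g‖ ^ p ≤ ENNReal.ofReal (C * ‖f‖) ^ p := by
      rw [← tsum_enorm_seqSpace h0 ht g, ENNReal.ofReal_mul hC,
        ENNReal.mul_rpow_of_nonneg _ _ hp0.le, ← tsum_enorm_seqSpace h0 ht f]
      exact (ENNReal.tsum_le_tsum fun m => ENNReal.rpow_le_rpow (hg m) hp0.le).trans
        (h.tsum_rpow_le hp _)
    exact (ENNReal.ofReal_le_ofReal_iff (by positivity)).1 ((ENNReal.rpow_le_rpow_iff hp0).1 h1)

/-- The matrix `a` has finite row sums and column sums of norms. -/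
def SchurClass (a : Idx d → Idx d → (E →L[ℂ] F)) : Prop :=
  ∃ C : ℝ≥0∞, C ≠ ∞ ∧ SchurBound (fun m n => ‖a m n‖ₑ) C

theorem enorm_matrix_apply_le (a : Idx d → Idx d → (E →L[ℂ] F)) (f : Idx d → E) (m : Idx d) :
    ‖∑' n, a m n (f n)‖ₑ ≤ ∑' n, ‖a m n‖ₑ * ‖f n‖ₑ :=
  enorm_tsum_le_tsum_enorm.trans (ENNReal.tsum_le_tsum fun n => (a m n).le_opENorm (f n))

theorem SchurClass.enorm_apply_le {a : Idx d → Idx d → (E →L[ℂ] F)} {C : ℝ≥0∞}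
    (hC : SchurBound (fun m n => ‖a m n‖ₑ) C) (f : Linf d E) (m : Idx d) :
    ∑' n, ‖a m n‖ₑ * ‖f n‖ₑ ≤ C * ‖f‖ₑ := by
  calc ∑' n, ‖a m n‖ₑ * ‖f n‖ₑ ≤ ∑' n, ‖a m n‖ₑ * ‖f‖ₑ :=
        ENNReal.tsum_le_tsum fun n => mul_le_mul_right (SlantedFrames.enorm_apply_le f n) _
    _ ≤ C * ‖f‖ₑ := by
        rw [ENNReal.tsum_mul_right]
        exact mul_le_mul_left (hC.1 m) _

theorem SchurClass.summable {a : Idx d → Idx d → (E →L[ℂ] F)} (ha : SchurClass a) (f : Linf d E)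
    (m : Idx d) : Summable fun n => ‖a m n (f n)‖ := by
  obtain ⟨C, hC, h⟩ := ha
  refine summable_norm_iff_enorm.2 (ne_top_of_le_ne_top (b := C * ‖f‖ₑ) ?_ ?_)
  · exact ENNReal.mul_ne_top hC (by simp)
  · exact (ENNReal.tsum_le_tsum fun n => (a m n).le_opENorm (f n)).trans
      (SchurClass.enorm_apply_le h f m)

/-- The operator on `ℓ^∞` given by a matrix of Schur class. -/
noncomputable def matOp [CompleteSpace F] (a : Idx d → Idx d → (E →L[ℂ] F)) (ha : SchurClass a) :
    Linf d E →L[ℂ] Linf d F :=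
  have hb : ∀ (f : Linf d E) m, ‖∑' n, a m n (f n)‖ ≤ ha.choose.toReal * ‖f‖ := fun f m => by
    rw [← ENNReal.ofReal_le_ofReal_iff (by positivity), ofReal_norm,
      ENNReal.ofReal_mul ENNReal.toReal_nonneg, ENNReal.ofReal_toReal ha.choose_spec.1, ofReal_norm]
    exact (enorm_matrix_apply_le a _ m).trans (SchurClass.enorm_apply_le ha.choose_spec.2 f m)
  LinearMap.mkContinuous
    { toFun := fun f => ⟨fun m => ∑' n, a m n (f n),
        memℓp_infty ⟨_, by rintro _ ⟨m, rfl⟩; exact hb f m⟩⟩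
      map_add' := fun f g => by
        refine lp.ext (funext fun m => ?_)
        change ∑' n, a m n (f n + g n) = ∑' n, a m n (f n) + ∑' n, a m n (g n)
        rw [← (ha.summable f m).of_norm.tsum_add (ha.summable g m).of_norm]
        simp only [map_add]
      map_smul' := fun c f => by
        refine lp.ext (funext fun m => ?_)
        change ∑' n, a m n (c • f n) = c • ∑' n, a m n (f n)
        rw [← (ha.summable f m).of_norm.tsum_const_smul c]
        simp only [map_smul] }
    ha.choose.toReal (fun f => lp.norm_le_of_forall_le (by positivity) (hb f))

theorem matOp_apply [CompleteSpace F] (a : Idx d → Idx d → (E →L[ℂ] F)) (ha : SchurClass a)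
    (f : Linf d E) (m : Idx d) : matOp a ha f m = ∑' n, a m n (f n) := rfl

theorem matOp_single [CompleteSpace F] (a : Idx d → Idx d → (E →L[ℂ] F)) (ha : SchurClass a)
    (n : Idx d) (h : E) (m : Idx d) : matOp a ha (lp.single ∞ n h) m = a m n h := by
  rw [matOp_apply, tsum_eq_single n]
  · simp
  · intro k hk
    simp [lp.single_apply, hk]

theorem preserves_matOp [CompleteSpace F] (a : Idx d → Idx d → (E →L[ℂ] F)) (ha : SchurClass a) :
    Preserves (matOp a ha) := by
  refine preserves_of_summable fun q hq f hf => ?_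
  have hq0 : 0 ≤ q := zero_le_one.trans hq
  obtain ⟨C, hC, h⟩ := ha
  rw [summable_rpow_iff hq0] at hf ⊢
  refine ne_top_of_le_ne_top (ENNReal.mul_ne_top (ENNReal.rpow_ne_top_of_nonneg hq0 hC) hf)
    (le_trans (ENNReal.tsum_le_tsum fun m => ENNReal.rpow_le_rpow ?_ hq0) (h.tsum_rpow_le hq _))
  exact enorm_matrix_apply_le a _ m

end Schur

theorem isAdj_matOp {d : ℕ} {E F : Type*} [NormedAddCommGroup E] [InnerProductSpace ℂ E]
    [CompleteSpace E] [NormedAddCommGroup F] [InnerProductSpace ℂ F] [CompleteSpace F]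
    (a : Idx d → Idx d → (E →L[ℂ] F)) (ha : SchurClass a) :
    IsAdj (matOp a ha) (adjOp (matOp a ha) (preserves_matOp a ha)) := by
  obtain ⟨W, hW, hW0⟩ := exists_isAdj (matOp a ha) (preserves_matOp a ha)
  convert hW using 1
  ext1 f
  refine lp.ext (funext fun m => ext_inner_left ℂ fun x => ?_)
  set v := adjOp (matOp a ha) (preserves_matOp a ha) (lp.single ∞ m x) with hv
  -- the coordinates of a weak* continuous operator are given by absolutely convergent series
  rw [← pairing_single_right (fun n => W f n), hW.pairing_of_right _ _ (memℓp_one_single m x),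
    ← hv, matOp_apply, pairing]
  have h1 : ∀ n, inner ℂ (v n) (f n) = inner ℂ x (a m n (f n)) := fun n => by
    rw [hv, inner_adjOp, pairing_single_right, matOp_single]
  simp only [h1]
  exact ((innerSL ℂ x).map_tsum (ha.summable f m).of_norm)

/-! ### Slanted kernels -/

section Slant

variable {d : ℕ}

/-- The distance `|αm - n|` in the sup norm. -/
noncomputable def slantDist (α : ℝ) (m n : Idx d) : ℝ := ‖fun k => α * (m k : ℝ) - (n k : ℝ)‖

/-- The index of the slant that contains the position `(m, n)`. -/
noncomputable def slantIdx (α : ℝ) (m n : Idx d) : Idx d := fun k => ⌊α * (m k : ℝ) - (n k : ℝ)⌋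

theorem slantDist_nonneg (α : ℝ) (m n : Idx d) : 0 ≤ slantDist α m n := norm_nonneg _

theorem norm_idx (j : Idx d) : ‖fun k => (j k : ℝ)‖ = ‖j‖ := by
  simp only [Pi.norm_def]
  congr 2

theorem abs_slantDist_sub_le (α : ℝ) (m n : Idx d) :
    |slantDist α m n - ‖slantIdx α m n‖| ≤ 1 := by
  rw [slantDist, ← norm_idx]
  refine (abs_norm_sub_norm_le _ _).trans ((pi_norm_le_iff_of_nonneg zero_le_one).2 fun k => ?_)
  rw [Pi.sub_apply, Real.norm_eq_abs, slantIdx, Int.self_sub_floor,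
    abs_of_nonneg (Int.fract_nonneg _)]
  exact (Int.fract_lt_one _).le

theorem injective_slantIdx (α : ℝ) (m : Idx d) : Function.Injective fun n => slantIdx α m n := by
  intro n n' h
  funext k
  have h1 : ⌊α * (m k : ℝ) - (n k : ℝ)⌋ = ⌊α * (m k : ℝ) - (n' k : ℝ)⌋ := congrFun h k
  rw [Int.floor_sub_intCast, Int.floor_sub_intCast] at h1
  omega

/-- For fixed `n`, an index `m` is determined by the slant that contains `(m, n)` and the residue
of `m` modulo an integer `L ≥ 1 / |α|`. -/
theorem injective_slantIdx_mod {α : ℝ} (hα : α ≠ 0) {L : ℕ} (hL : |α⁻¹| ≤ L) (n : Idx d) :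
    Function.Injective fun m : Idx d => (slantIdx α m n, fun k => ((m k : ℤ) : ZMod L)) := by
  intro m m' h
  funext k
  have h1 : ⌊α * (m k : ℝ) - (n k : ℝ)⌋ = ⌊α * (m' k : ℝ) - (n k : ℝ)⌋ :=
    congrFun (congrArg Prod.fst h) k
  have h2 : ((m k : ℤ) : ZMod L) = ((m' k : ℤ) : ZMod L) := congrFun (congrArg Prod.snd h) k
  have h3 := Int.abs_sub_lt_one_of_floor_eq_floor h1
  have h4 : |α * ((m k : ℝ) - (m' k : ℝ))| < 1 := by
    rwa [mul_sub, ← sub_sub_sub_cancel_right _ _ (n k : ℝ)]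
  rw [abs_mul] at h4
  have h5 : |(m k : ℝ) - (m' k : ℝ)| < L := by
    refine lt_of_lt_of_le ?_ hL
    rw [abs_inv, ← one_div, lt_div_iff₀' (abs_pos.2 hα)]
    exact h4
  rw [ZMod.intCast_eq_intCast_iff_dvd_sub] at h2
  have h6 : |m' k - m k| < (L : ℤ) := by
    rw [abs_sub_comm]; exact_mod_cast h5
  have := Int.eq_zero_of_abs_lt_dvd h2 h6
  omega

/-- A kernel dominated by a function of the slant index is a Schur kernel if that function is
summable. -/
theorem schurBound_of_slantIdx {α : ℝ} (hα : α ≠ 0) (u : Idx d → ℝ≥0∞) (hu : ∑' j, u j ≠ ∞) :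
    ∃ C : ℝ≥0∞, C ≠ ∞ ∧ SchurBound (fun m n => u (slantIdx α m n)) C := by
  set L := ⌈|α⁻¹|⌉₊ with hL
  have hLpos : 0 < L := Nat.ceil_pos.2 (abs_pos.2 (inv_ne_zero hα))
  have : NeZero L := ⟨hLpos.ne'⟩
  refine ⟨(Fintype.card (Fin d → ZMod L) : ℝ≥0∞) * ∑' j, u j,
    ENNReal.mul_ne_top (ENNReal.natCast_ne_top _) hu, fun m => ?_, fun n => ?_⟩
  · refine (ENNReal.tsum_comp_le_tsum_of_injective (injective_slantIdx α m) u).trans ?_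
    exact le_mul_of_one_le_left zero_le (by exact_mod_cast Fintype.card_pos)
  · refine (ENNReal.tsum_comp_le_tsum_of_injective (injective_slantIdx_mod hα (Nat.le_ceil _) n)
      fun x => u x.1).trans_eq ?_
    rw [ENNReal.tsum_prod (f := fun j _ => u j), ← ENNReal.tsum_mul_left]
    refine tsum_congr fun j => ?_
    rw [tsum_fintype, Finset.sum_const, Finset.card_univ, nsmul_eq_mul]

theorem tsum_one_add_norm_pow_inv_ne_top (d : ℕ) :
    ∑' j : Idx d, ENNReal.ofReal (((1 + ‖j‖) ^ (d + 1))⁻¹) ≠ ∞ := by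
  set L := Submodule.span ℤ (Set.range (Pi.basisFun ℝ (Fin d))) with hL
  have hs := ZLattice.summable_norm_pow_inv L (d + 1) (by
    rw [ZLattice.rank ℝ L]; simp)
  have hmem : ∀ j : Idx d, (fun k => (j k : ℝ)) ∈ L := fun j => by
    rw [hL, (Pi.basisFun ℝ (Fin d)).mem_span_iff_repr_mem ℤ]
    intro k
    simp
  let e : Idx d → L := fun j => ⟨fun k => (j k : ℝ), hmem j⟩
  have he : Function.Injective e := fun i j h => by
    funext k
    exact Int.cast_injective (α := ℝ) (congrFun (congrArg Subtype.val h) k)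
  have h1 := hs.comp_injective he
  have h2 : Summable fun j : Idx d => ((1 + ‖j‖) ^ (d + 1))⁻¹ := by
    refine Summable.of_norm_bounded_eventually h1 ?_
    filter_upwards [(Set.finite_singleton (0 : Idx d)).compl_mem_cofinite] with j hj
    have hj0 : 0 < ‖j‖ := norm_pos_iff.2 hj
    have h3 : ‖e j‖ = ‖j‖ := norm_idx j
    rw [Function.comp_apply, h3, Real.norm_of_nonneg (by positivity), inv_pow]
    gcongr
    linarith
  rw [← ENNReal.ofReal_tsum_of_nonneg (fun n => by positivity) h2]
  exact ENNReal.ofReal_ne_top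

end Slant

/-! ### Polynomial weights -/

section Weights

variable {d : ℕ}

theorem SchurBound.swap {ι κ : Type*} {k : ι → κ → ℝ≥0∞} {C : ℝ≥0∞} (h : SchurBound k C) :
    SchurBound (fun n m => k m n) C := ⟨h.2, h.1⟩

theorem half_le_slantDist (α : ℝ) (m n : Idx d) :
    (1 + ‖slantIdx α m n‖) / 2 ≤ 1 + slantDist α m n := by
  have h1 := (abs_le.1 (abs_slantDist_sub_le α m n)).1
  have h2 := slantDist_nonneg α m n
  linarith

theorem slantDist_le (α : ℝ) (m n : Idx d) :
    1 + slantDist α m n ≤ 2 * (1 + ‖slantIdx α m n‖) := by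
  have h1 := (abs_le.1 (abs_slantDist_sub_le α m n)).2
  have h2 := norm_nonneg (slantIdx α m n)
  linarith

/-- The polynomial weight centred at `x`, at scale `N`, evaluated at `αm`. -/
noncomputable def slantWeight (α N : ℝ) (x m : Idx d) : ℝ :=
  ((1 + slantDist α m x / N) ^ (d + 1))⁻¹

theorem slantWeight_nonneg (α : ℝ) {N : ℝ} (hN : 0 < N) (x m : Idx d) :
    0 ≤ slantWeight α N x m := by
  have := slantDist_nonneg α m x
  unfold slantWeight
  positivity

theorem schurBound_slantWeight {α N : ℝ} (hα : α ≠ 0) (hN : 1 ≤ N) :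
    ∃ C : ℝ≥0∞, C ≠ ∞ ∧
      SchurBound (fun x m : Idx d => ENNReal.ofReal (slantWeight α N x m)) C := by
  set c := ENNReal.ofReal ((2 * N) ^ (d + 1)) with hc
  obtain ⟨C, hC, h⟩ := schurBound_of_slantIdx hα
    (fun j : Idx d => c * ENNReal.ofReal (((1 + ‖j‖) ^ (d + 1))⁻¹)) (by
      rw [ENNReal.tsum_mul_left]
      exact ENNReal.mul_ne_top ENNReal.ofReal_ne_top (tsum_one_add_norm_pow_inv_ne_top d))
  refine ⟨C, hC, (h.mono fun m x => ?_).swap⟩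
  rw [hc, ← ENNReal.ofReal_mul (by positivity)]
  refine ENNReal.ofReal_le_ofReal ?_
  have h1 := half_le_slantDist α m x
  have h2 := slantDist_nonneg α m x
  have h3 := norm_nonneg (slantIdx α m x)
  have hN0 : 0 < N := by linarith
  unfold slantWeight
  rw [← div_eq_mul_inv, ← div_pow, ← inv_pow]
  refine pow_le_pow_left₀ (by positivity) ?_ _
  rw [inv_le_comm₀ (by positivity) (by positivity), inv_div, div_le_iff₀ (by positivity)]
  have h4 : (1 + slantDist α m x / N) * (2 * N) = 2 * (N + slantDist α m x) := by
    field_simp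
  rw [h4]
  linarith

theorem slantDist_triangle (α : ℝ) (m n x : Idx d) :
    slantDist α m x ≤ slantDist α m n + slantDist 1 n x := by
  unfold slantDist
  refine le_of_eq_of_le ?_ (norm_add_le _ _)
  congr 1
  funext k
  simp

theorem slantDist_triangle' (α : ℝ) (m n x : Idx d) :
    slantDist 1 n x ≤ slantDist α m n + slantDist α m x := by
  unfold slantDist
  refine le_of_eq_of_le ?_ (norm_sub_le _ _)
  rw [← norm_neg]
  congr 1
  funext k
  simp

theorem one_add_div_pow_sub_one_le {R N : ℝ} (hR : 0 ≤ R) (hN : 1 ≤ N) (t : ℕ) :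
    (1 + R / N) ^ t - 1 ≤ ((1 + R) ^ t - 1) / N := by
  have hN0 : 0 < N := by linarith
  induction t with
  | zero => simp
  | succ t ih =>
    have h1 : (1 + R / N) ^ t ≤ (1 + R) ^ t := by
      gcongr
      exact div_le_self hR hN
    calc (1 + R / N) ^ (t + 1) - 1 = ((1 + R / N) ^ t - 1) + R / N * (1 + R / N) ^ t := by ring
      _ ≤ ((1 + R) ^ t - 1) / N + R / N * (1 + R) ^ t := by gcongr
      _ = _ := by field_simp; ring

theorem abs_inv_pow_sub_le {A B r : ℝ} (hA : 1 ≤ A) (hB : 1 ≤ B) (hr : |A - B| ≤ r) (t : ℕ) :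
    |(A ^ t)⁻¹ - (B ^ t)⁻¹| ≤ (A ^ t)⁻¹ * ((1 + r) ^ t - 1) := by
  have hA0 : 0 < A := by linarith
  have hB0 : 0 < B := by linarith
  have hr0 : 0 ≤ r := (abs_nonneg _).trans hr
  obtain ⟨h1, h2⟩ := abs_le.1 hr
  have hAB : (A / B) ^ t ≤ (1 + r) ^ t := by
    refine pow_le_pow_left₀ (by positivity) ?_ _
    rw [div_le_iff₀ hB0]
    nlinarith
  have hBA : (B / A) ^ t ≤ (1 + r) ^ t := by
    refine pow_le_pow_left₀ (by positivity) ?_ _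
    rw [div_le_iff₀ hA0]
    nlinarith
  have h3 : (A ^ t)⁻¹ - (B ^ t)⁻¹ = (A ^ t)⁻¹ * (1 - (A / B) ^ t) := by
    rw [div_pow]; field_simp
  rw [h3, abs_mul, abs_of_pos (by positivity)]
  refine mul_le_mul_of_nonneg_left (abs_le.2 ⟨by linarith, ?_⟩) (by positivity)
  have h4 : (A / B) ^ t * (B / A) ^ t = 1 := by
    rw [← mul_pow]; field_simp; simp
  have h5 : 0 < (A / B) ^ t := by positivity
  nlinarith [sq_nonneg ((A / B) ^ t - 1)]

/-- The commutator estimate for the weights: replacing `n` by `αm` changes the weight by a factor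
that is polynomial in `|αm - n|` and small at large scales. -/
theorem abs_slantWeight_sub_le (α : ℝ) {N : ℝ} (hN : 1 ≤ N) (x m n : Idx d) :
    |slantWeight 1 N x n - slantWeight α N x m| ≤
      slantWeight 1 N x n * ((1 + slantDist α m n) ^ (d + 1) / N) := by
  have hN0 : 0 < N := by linarith
  have h1 := slantDist_nonneg 1 n x
  have h2 := slantDist_nonneg α m x
  have h3 := slantDist_nonneg α m n
  refine (abs_inv_pow_sub_le (r := slantDist α m n / N) (by simpa using by positivity)
    (by simpa using by positivity) ?_ (d + 1)).trans ?_
  · rw [add_sub_add_left_eq_sub, ← sub_div, abs_div, abs_of_pos hN0]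
    gcongr
    rw [abs_le]
    constructor
    · linarith [slantDist_triangle α m n x]
    · linarith [slantDist_triangle' α m n x]
  · refine mul_le_mul_of_nonneg_left ?_ (slantWeight_nonneg 1 hN0 x n)
    refine (one_add_div_pow_sub_one_le h3 hN _).trans ?_
    gcongr
    linarith

end Weights

/-! ### Stability of slanted matrices -/

section Stability

variable {d : ℕ} {E F : Type*} [NormedAddCommGroup E] [NormedSpace ℂ E]
  [NormedAddCommGroup F] [NormedSpace ℂ F]

/-- The rows and the columns of `‖a_{mn}‖ (1 + |αm - n|)^(d+1)` have bounded sums. This is weaker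
than membership in `Σ_α^ω` for weights `ω` that dominate `(1 + |n|)^(d+1)`. -/
def SlantedSchur (α : ℝ) (a : Idx d → Idx d → (E →L[ℂ] F)) : Prop :=
  ∃ C : ℝ, 0 ≤ C ∧ SchurBound
    (fun m n => ‖a m n‖ₑ * ENNReal.ofReal ((1 + slantDist α m n) ^ (d + 1))) (ENNReal.ofReal C)

theorem SlantedSchur.schurClass {α : ℝ} {a : Idx d → Idx d → (E →L[ℂ] F)}
    (h : SlantedSchur α a) : SchurClass a := by
  obtain ⟨C, hC, h⟩ := h
  refine ⟨ENNReal.ofReal C, ENNReal.ofReal_ne_top, h.mono fun m n => ?_⟩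
  refine le_mul_of_one_le_right zero_le ?_
  rw [ENNReal.one_le_ofReal]
  exact one_le_pow₀ (by linarith [slantDist_nonneg α m n])

theorem MemSigma.slantedSchur {α s : ℝ} (hα : α ≠ 0) (hs : (d : ℝ) + 1 ≤ s)
    {a : Idx d → Idx d → (E →L[ℂ] F)} (h : MemSigma α (polyWeight d s) a) : SlantedSchur α a := by
  have hsum : ∑' j : Idx d, (⨆ m : Idx d, ⨆ n : Idx d, ‖slant α j a m n‖ₑ) *
      ENNReal.ofReal (polyWeight d s j) ≠ ∞ := by
    have hK : ((⌈|α⁻¹|⌉₊ ^ d : ℕ) : ℝ≥0∞) ≠ 0 := by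
      have : 0 < ⌈|α⁻¹|⌉₊ := Nat.ceil_pos.2 (abs_pos.2 (inv_ne_zero hα))
      exact_mod_cast (pow_pos this d).ne'
    intro htop
    rw [MemSigma, slantedNorm, htop, ENNReal.mul_top hK] at h
    exact lt_irrefl _ h
  obtain ⟨C, hC, hb⟩ := schurBound_of_slantIdx hα (fun j : Idx d => ENNReal.ofReal (2 ^ (d + 1)) *
      ((⨆ m : Idx d, ⨆ n : Idx d, ‖slant α j a m n‖ₑ) * ENNReal.ofReal (polyWeight d s j))) (by
    rw [ENNReal.tsum_mul_left]
    exact ENNReal.mul_ne_top ENNReal.ofReal_ne_top hsum)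
  refine ⟨C.toReal, ENNReal.toReal_nonneg, ?_⟩
  rw [ENNReal.ofReal_toReal hC]
  refine hb.mono fun m n => ?_
  rw [mul_left_comm, ← ENNReal.ofReal_mul (by positivity)]
  have h1 : ‖a m n‖ₑ ≤ ⨆ m' : Idx d, ⨆ n' : Idx d, ‖slant α (slantIdx α m n) a m' n'‖ₑ := by
    refine le_trans (le_of_eq ?_) (le_iSup₂ (f := fun m' n' =>
      ‖slant α (slantIdx α m n) a m' n'‖ₑ) m n)
    -- the position `(m, n)` lies on its own slant
    rw [slant, if_pos]
    exact fun k => ⟨Int.floor_le _, Int.lt_floor_add_one _⟩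
  refine mul_le_mul' h1 (ENNReal.ofReal_le_ofReal ?_)
  have hj := norm_nonneg (slantIdx α m n)
  calc (1 + slantDist α m n) ^ (d + 1) ≤ (2 * (1 + ‖slantIdx α m n‖)) ^ (d + 1) := by
        have := slantDist_nonneg α m n
        exact pow_le_pow_left₀ (by linarith) (slantDist_le α m n) _
    _ = 2 ^ (d + 1) * (1 + ‖slantIdx α m n‖) ^ ((d : ℝ) + 1) := by
        rw [mul_pow, ← Real.rpow_natCast (1 + ‖slantIdx α m n‖)]
        push_cast
        rfl
    _ ≤ 2 ^ (d + 1) * polyWeight d s (slantIdx α m n) := by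
        unfold polyWeight
        gcongr
        linarith

/-- A bounded sequence times a weight is in `ℓ^1`. -/
theorem memℓp_slantWeight_smul {α N : ℝ} (hα : α ≠ 0) (hN : 1 ≤ N) (x : Idx d) (g : Linf d E) :
    Memℓp (fun n => (slantWeight α N x n : ℂ) • g n) 1 := by
  have hN0 : 0 < N := by linarith
  obtain ⟨C, hC, h⟩ := schurBound_slantWeight (d := d) hα hN
  refine memℓp_gen ?_
  rw [summable_rpow_iff (by simp)]
  simp only [ENNReal.toReal_one, ENNReal.rpow_one, enorm_smul]
  refine ne_top_of_le_ne_top (ENNReal.mul_ne_top hC (enorm_ne_top (x := g)))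
    ((ENNReal.tsum_le_tsum fun n => mul_le_mul_right (enorm_apply_le g n) _).trans ?_)
  rw [ENNReal.tsum_mul_right]
  refine mul_le_mul_left ((ENNReal.tsum_le_tsum fun n => ?_).trans (h.1 x)) _
  rw [← ofReal_norm, Complex.norm_real, Real.norm_of_nonneg (slantWeight_nonneg α hN0 x n)]

/-- Stability does not depend on the space: if a slanted matrix is bounded below on one of the
spaces `ℓ^p`, `𝔠₀`, then every bounded sequence `f` is dominated pointwise by a Schur kernel applied
to `Af`. The lower bound is applied to `f` times a polynomial weight centred at `x`; the commutator
of `A` with the weight is absorbed by choosing the scale `N` of the weight large. -/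
theorem exists_pointwise_bound [CompleteSpace E] [CompleteSpace F] {α : ℝ} (hα : α ≠ 0)
    {a : Idx d → Idx d → (E →L[ℂ] F)} (ha : SlantedSchur α a) (p : Exponent) {c : ℝ} (hc : 0 < c)
    (hlow : ∀ f : SeqSpace d E p, c * ‖f‖ ≤
      ‖seqMap (matOp a ha.schurClass) (preserves_matOp a ha.schurClass) p f‖) :
    ∃ (K : Idx d → Idx d → ℝ≥0∞) (C : ℝ≥0∞), C ≠ ∞ ∧ SchurBound K C ∧
      ∀ (f : Linf d E) x, ‖f x‖ₑ ≤ ∑' m, K x m * ‖matOp a ha.schurClass f m‖ₑ := by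
  have hS := ha.schurClass
  obtain ⟨Ca, hCa, hSch⟩ := ha
  -- the scale at which the commutator costs at most half of the lower bound
  obtain ⟨N, hN1, hN2⟩ : ∃ N : ℝ, 1 ≤ N ∧ N⁻¹ * Ca ≤ c / 2 := by
    refine ⟨max 1 (2 * Ca / c), le_max_left _ _, ?_⟩
    have h1 : 0 < max 1 (2 * Ca / c) := lt_max_of_lt_left one_pos
    rw [inv_mul_le_iff₀ h1]
    calc Ca = (2 * Ca / c) * (c / 2) := by field_simp
      _ ≤ _ := by
        gcongr
        exact le_max_right _ _
  have hN0 : 0 < N := by linarith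
  obtain ⟨CK, hCK, hK⟩ := schurBound_slantWeight (d := d) hα hN1
  refine ⟨fun x m => ENNReal.ofReal (2 / c) * ENNReal.ofReal (slantWeight α N x m),
    ENNReal.ofReal (2 / c) * CK, ENNReal.mul_ne_top ENNReal.ofReal_ne_top hCK, hK.const_mul _,
    fun f x => ?_⟩
  set T := matOp a hS with hT
  set w : Idx d → ℝ := slantWeight 1 N x with hw
  set w' : Idx d → ℝ := slantWeight α N x with hw'
  have hwf := memℓp_slantWeight_smul one_ne_zero hN1 x f
  have hwT := memℓp_slantWeight_smul hα hN1 x (T f)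
  let wf : SeqSpace d E p :=
    ofLinf p ⟨fun n => (w n : ℂ) • f n, hwf.of_exponent_ge le_top⟩ (memSeq_of_memℓp_one p hwf)
  let wT : SeqSpace d F p :=
    ofLinf p ⟨fun m => (w' m : ℂ) • T f m, hwT.of_exponent_ge le_top⟩ (memSeq_of_memℓp_one p hwT)
  -- the commutator of `A` with the weight
  have hcomm : ‖seqMap T (preserves_matOp a hS) p wf - wT‖ ≤ N⁻¹ * Ca * ‖wf‖ := by
    refine SchurBound.norm_le (k := fun m n => ENNReal.ofReal N⁻¹ *
      (‖a m n‖ₑ * ENNReal.ofReal ((1 + slantDist α m n) ^ (d + 1)))) (by positivity) ?_ _ _ ?_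
    · rw [ENNReal.ofReal_mul (by positivity)]
      exact hSch.const_mul _
    · intro m
      have h1 : (seqMap T (preserves_matOp a hS) p wf - wT).1 m =
          ∑' n, a m n (((w n - w' m : ℝ) : ℂ) • f n) := by
        change T (toLinf p wf) m - (w' m : ℂ) • T f m = _
        rw [hT, matOp_apply, matOp_apply, ← (hS.summable f m).of_norm.tsum_const_smul,
          ← (hS.summable (toLinf p wf) m).of_norm.tsum_sub
            ((hS.summable f m).of_norm.const_smul _)]
        refine tsum_congr fun n => ?_
        change a m n ((w n : ℂ) • f n) - (w' m : ℂ) • a m n (f n) = _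
        rw [← map_smul, ← map_sub, ← sub_smul, Complex.ofReal_sub]
      rw [h1]
      refine (enorm_matrix_apply_le a (fun n => ((w n - w' m : ℝ) : ℂ) • f n) m).trans
        (ENNReal.tsum_le_tsum fun n => ?_)
      have h2 : ‖((w n - w' m : ℝ) : ℂ) • f n‖ₑ ≤
          ENNReal.ofReal (N⁻¹ * (1 + slantDist α m n) ^ (d + 1)) * ‖wf.1 n‖ₑ := by
        rw [← ofReal_norm, ← ofReal_norm, ← ENNReal.ofReal_mul (by
          have := slantDist_nonneg α m n
          positivity)]
        refine ENNReal.ofReal_le_ofReal ?_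
        change _ ≤ _ * ‖(w n : ℂ) • f n‖
        rw [norm_smul, norm_smul, ← mul_assoc, Complex.norm_real, Complex.norm_real,
          Real.norm_eq_abs, Real.norm_of_nonneg (slantWeight_nonneg 1 hN0 x n)]
        refine mul_le_mul_of_nonneg_right ?_ (norm_nonneg _)
        refine (abs_slantWeight_sub_le α hN1 x m n).trans_eq ?_
        field_simp
      refine (mul_le_mul_right h2 _).trans_eq ?_
      rw [ENNReal.ofReal_mul (by positivity)]
      ring
  have hw0 : ∀ m, 0 ≤ w' m := slantWeight_nonneg α hN0 x
  have hsum : Summable fun m => w' m * ‖T f m‖ := by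
    have h2 := (memℓp_gen_iff (p := 1) (by simp)).1 hwT
    simpa only [ENNReal.toReal_one, Real.rpow_one, norm_smul, Complex.norm_real,
      Real.norm_of_nonneg (slantWeight_nonneg α hN0 x _)] using h2
  have hwTn : ‖wT‖ ≤ ∑' m, w' m * ‖T f m‖ := by
    refine SeqSpace.norm_le_of_hasSum wT ?_
    have h1 : ∀ m, ‖wT.1 m‖ = w' m * ‖T f m‖ := fun m => by
      change ‖(w' m : ℂ) • T f m‖ = _
      rw [norm_smul, Complex.norm_real, Real.norm_of_nonneg (slantWeight_nonneg α hN0 x m)]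
    simp only [h1]
    exact hsum.hasSum
  -- `w x = 1`, and the commutator term is absorbed on the left
  have hfin : ‖f x‖ ≤ 2 / c * ∑' m, w' m * ‖T f m‖ := by
    have h1 := hlow wf
    have h2 : ‖seqMap T (preserves_matOp a hS) p wf‖ ≤ ‖wT‖ + c / 2 * ‖wf‖ := by
      calc _ = ‖wT + (seqMap T (preserves_matOp a hS) p wf - wT)‖ := by rw [add_sub_cancel]
        _ ≤ ‖wT‖ + N⁻¹ * Ca * ‖wf‖ := (norm_add_le _ _).trans (add_le_add_right hcomm _)
        _ ≤ _ := by gcongr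
    have h3 : ‖f x‖ ≤ ‖wf‖ := by
      refine le_trans (le_of_eq ?_) (lp.norm_apply_le_norm p.normExp_ne_zero wf.1 x)
      change _ = ‖(w x : ℂ) • f x‖
      have : w x = 1 := by
        have h0 : slantDist 1 x x = 0 := by
          rw [slantDist, norm_eq_zero]
          funext k
          simp
        simp [hw, slantWeight, h0]
      simp [this]
    rw [div_mul_eq_mul_div, le_div_iff₀ hc]
    nlinarith
  refine (ofReal_norm (f x)).symm.trans_le ((ENNReal.ofReal_le_ofReal hfin).trans_eq ?_)
  rw [ENNReal.ofReal_mul (by positivity), ENNReal.ofReal_tsum_of_nonneg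
    (fun m => mul_nonneg (hw0 m) (norm_nonneg _)) hsum, ← ENNReal.tsum_mul_left]
  refine tsum_congr fun m => ?_
  rw [ENNReal.ofReal_mul (hw0 m), ofReal_norm, mul_assoc]

end Stability

/-! ### Inverting the Gram operator -/

section Hilbert

variable {d : ℕ} {E F : Type*} [NormedAddCommGroup E] [InnerProductSpace ℂ E]
  [NormedAddCommGroup F] [InnerProductSpace ℂ F]

abbrev Exponent.two : Exponent := ⟨2, Or.inr one_le_two⟩

theorem memSeq_two_iff {E : Type*} [NormedAddCommGroup E] {f : Idx d → E} :
    MemSeq Exponent.two f ↔ Memℓp f 2 := by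
  simp [MemSeq, Exponent.normExp]

/-- `ℓ^2` in the family `SeqSpace`, identified with the Hilbert space `ℓ^2` of Mathlib. -/
noncomputable def l2Equiv (d : ℕ) (E : Type*) [NormedAddCommGroup E] [InnerProductSpace ℂ E] :
    SeqSpace d E Exponent.two ≃ₗᵢ[ℂ] lp (fun _ : Idx d => E) 2 where
  toFun f := ⟨fun n => f.1 n, memSeq_two_iff.1 (memSeq_coe _ f)⟩
  invFun f := ⟨⟨fun n => f n, (memSeq_two_iff.2 (lp.memℓp f)).1⟩,
    (memSeq_two_iff.2 (lp.memℓp f)).2⟩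
  map_add' _ _ := rfl
  map_smul' _ _ := rfl
  left_inv _ := rfl
  right_inv _ := rfl
  norm_map' f := by
    have h1 := SeqSpace.hasSum_norm (by simp) (by simp) f
    have h2 := lp.hasSum_norm (p := 2) (by simp)
      (⟨fun n => f.1 n, memSeq_two_iff.1 (memSeq_coe _ f)⟩ : lp (fun _ : Idx d => E) 2)
    have h3 := h2.unique h1
    exact (Real.rpow_left_inj (norm_nonneg _) (norm_nonneg _) (by simp)).1 h3

/-- The inclusion of the Hilbert space `ℓ^2` into `ℓ^∞`. -/
noncomputable def l2ToLinf (f : lp (fun _ : Idx d => E) 2) : Linf d E :=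
  toLinf _ ((l2Equiv d E).symm f)

@[simp] theorem l2ToLinf_single (n : Idx d) (h : E) :
    l2ToLinf (lp.single 2 n h) = lp.single ∞ n h := lp.ext rfl

/-- The entry `(x, y)` of the matrix of an operator on sequences. -/
noncomputable def entry (U : Linf d E →L[ℂ] Linf d F) (x y : Idx d) : E →L[ℂ] F :=
  lp.evalCLM ℂ (fun _ : Idx d => F) ∞ x ∘L U ∘L
    lp.singleContinuousLinearMap ℂ (fun _ : Idx d => E) ∞ y

theorem entry_apply (U : Linf d E →L[ℂ] Linf d F) (x y : Idx d) (h : E) :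
    entry U x y h = U (lp.single ∞ y h) x := rfl

theorem enorm_le_of_forall_enorm_le {B : E →L[ℂ] F} {c : ℝ≥0∞} (hc : c ≠ ∞)
    (h : ∀ x, ‖B x‖ₑ ≤ c * ‖x‖ₑ) : ‖B‖ₑ ≤ c := by
  rw [← ENNReal.ofReal_toReal hc, ← ofReal_norm]
  refine ENNReal.ofReal_le_ofReal (B.opNorm_le_bound ENNReal.toReal_nonneg fun x => ?_)
  rw [← ENNReal.ofReal_le_ofReal_iff (by positivity), ENNReal.ofReal_mul ENNReal.toReal_nonneg,
    ofReal_norm, ofReal_norm, ENNReal.ofReal_toReal hc]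
  exact h x

variable [CompleteSpace E] [CompleteSpace F]

/-- A space-preserving operator, on the Hilbert space `ℓ^2`. -/
noncomputable def l2Map (U : Linf d E →L[ℂ] Linf d F) (hU : Preserves U) :
    lp (fun _ : Idx d => E) 2 →L[ℂ] lp (fun _ : Idx d => F) 2 :=
  ((l2Equiv d F).toContinuousLinearEquiv : _ →L[ℂ] _) ∘L seqMap U hU Exponent.two ∘L
    ((l2Equiv d E).symm.toContinuousLinearEquiv : _ →L[ℂ] _)

theorem l2ToLinf_l2Map (U : Linf d E →L[ℂ] Linf d F) (hU : Preserves U)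
    (f : lp (fun _ : Idx d => E) 2) : l2ToLinf (l2Map U hU f) = U (l2ToLinf f) := rfl

theorem norm_l2Map (U : Linf d E →L[ℂ] Linf d F) (hU : Preserves U)
    (f : SeqSpace d E Exponent.two) :
    ‖l2Map U hU (l2Equiv d E f)‖ = ‖seqMap U hU Exponent.two f‖ :=
  (l2Equiv d F).norm_map _

theorem adjoint_comp_l2Map {U : Linf d E →L[ℂ] Linf d F} {V : Linf d F →L[ℂ] Linf d E}
    (h : IsAdj U V) :
    ContinuousLinearMap.adjoint (l2Map U h.left) ∘L l2Map U h.left =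
      l2Map (V ∘L U) (h.right.comp h.left) := by
  ext1 f
  refine lp.ext (funext fun n => ext_inner_left ℂ fun x => ?_)
  have h1 : ∀ g : lp (fun _ : Idx d => E) 2, inner ℂ (lp.single 2 n x) g = inner ℂ x (g n) :=
    fun g => lp.inner_single_left n x g
  rw [← h1, ContinuousLinearMap.comp_apply, ContinuousLinearMap.adjoint_inner_right,
    lp.inner_eq_tsum]
  have h2 := h.symm.pairing_of_right (U (l2ToLinf f)) (lp.single ∞ n x) (memℓp_one_single n x)
  rw [pairing_single_right] at h2
  change _ = inner ℂ x (V (U (l2ToLinf f)) n)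
  rw [h2, pairing, ← l2ToLinf_single, ← l2ToLinf_l2Map U h.left, ← l2ToLinf_l2Map U h.left]
  rfl

/-- If `A` is bounded below on `ℓ^2`, so is its Gram operator `A^* A`, and the latter is
invertible. -/
theorem isUnit_gram {U : Linf d E →L[ℂ] Linf d F} {V : Linf d F →L[ℂ] Linf d E}
    (h : IsAdj U V) {c : ℝ} (hc : 0 < c)
    (hlow : ∀ f : SeqSpace d E Exponent.two, c * ‖f‖ ≤ ‖seqMap U h.left _ f‖) :
    IsUnit (l2Map (V ∘L U) (h.right.comp h.left)) ∧
      ∀ f : SeqSpace d E Exponent.two,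
        c ^ 2 * ‖f‖ ≤ ‖seqMap (V ∘L U) (h.right.comp h.left) _ f‖ := by
  have hin : ∀ f : lp (fun _ : Idx d => E) 2, c ^ 2 * ‖f‖ ^ 2 ≤
      ‖inner ℂ (l2Map (V ∘L U) (h.right.comp h.left) f) f‖ := fun f => by
    rw [← adjoint_comp_l2Map h, ContinuousLinearMap.comp_apply,
      ContinuousLinearMap.adjoint_inner_left, inner_self_eq_norm_sq_to_K, ← mul_pow]
    have h1 := hlow ((l2Equiv d E).symm f)
    rw [← norm_l2Map, LinearIsometryEquiv.apply_symm_apply, LinearIsometryEquiv.norm_map] at h1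
    rw [norm_pow, RCLike.norm_ofReal, abs_of_nonneg (norm_nonneg _)]
    exact pow_le_pow_left₀ (by positivity) h1 2
  constructor
  · refine ContinuousLinearMap.isUnit_of_forall_le_norm_inner_map _
      (c := (c ^ 2).toNNReal)
      (Real.toNNReal_pos.2 (pow_pos hc 2)) fun f => ?_
    rw [mul_comm, Real.coe_toNNReal _ (by positivity)]
    exact hin f
  · intro f
    rw [← norm_l2Map]
    have h1 := (hin (l2Equiv d E f)).trans (norm_inner_le_norm _ _)
    rw [LinearIsometryEquiv.norm_map] at h1
    rcases (norm_nonneg f).eq_or_lt with h0 | h0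
    · rw [← h0, mul_zero]; exact norm_nonneg _
    · refine le_of_mul_le_mul_right ?_ h0
      rw [mul_assoc, ← pow_two]
      exact h1

theorem SchurBound.gram {ι κ : Type*} {k : ι → κ → ℝ≥0∞} {C : ℝ≥0∞} (h : SchurBound k C) :
    SchurBound (fun x y => ∑' m, k m x * k m y) (C * C) := by
  have key : ∀ x, ∑' y, ∑' m, k m x * k m y ≤ C * C := fun x => by
    rw [ENNReal.tsum_comm]
    calc ∑' m, ∑' y, k m x * k m y ≤ ∑' m, k m x * C :=
          ENNReal.tsum_le_tsum fun m => by
            rw [ENNReal.tsum_mul_left]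
            exact mul_le_mul_right (h.1 m) _
      _ ≤ C * C := by
          rw [ENNReal.tsum_mul_right]
          exact mul_le_mul_left (h.2 x) _
  refine ⟨key, fun y => ?_⟩
  simp only [mul_comm (k _ _) (k _ y)]
  exact key y

/-- The matrix of `A^* A` has the off-diagonal decay of `A`, because
`1 + |x - y| ≤ (1 + |αm - x|) (1 + |αm - y|)` for all `m`. -/
theorem slantedSchur_gram {α : ℝ} {a : Idx d → Idx d → (E →L[ℂ] F)} (ha : SlantedSchur α a) :
    SlantedSchur 1 (entry (adjOp (matOp a ha.schurClass) (preserves_matOp a ha.schurClass) ∘L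
      matOp a ha.schurClass)) := by
  have hS := ha.schurClass
  obtain ⟨C, hC, h⟩ := ha
  have h1 := h.gram
  rw [← ENNReal.ofReal_mul hC] at h1
  refine ⟨C * C, by positivity, h1.mono fun x y => ?_⟩
  have hfin : ∑' m, ‖a m x‖ₑ * ‖a m y‖ₑ ≠ ∞ := by
    obtain ⟨C', hC', h'⟩ := hS
    exact ne_top_of_le_ne_top (ENNReal.mul_ne_top hC' hC')
      ((ENNReal.le_tsum y).trans (h'.gram.1 x))
  have hent : ‖entry (adjOp (matOp a hS) (preserves_matOp a hS) ∘L matOp a hS) x y‖ₑ ≤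
      ∑' m, ‖a m x‖ₑ * ‖a m y‖ₑ := by
    refine enorm_le_of_forall_enorm_le hfin fun v => ?_
    set u := entry (adjOp (matOp a hS) (preserves_matOp a hS) ∘L matOp a hS) x y v with hu
    have h2 : ‖inner ℂ u u‖ₑ ≤ (∑' m, ‖a m x‖ₑ * ‖a m y‖ₑ) * ‖v‖ₑ * ‖u‖ₑ := by
      nth_rewrite 1 [hu]
      rw [entry_apply, ContinuousLinearMap.comp_apply, inner_adjOp, pairing]
      refine enorm_tsum_le_tsum_enorm.trans ?_
      rw [← ENNReal.tsum_mul_right, ← ENNReal.tsum_mul_right]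
      refine ENNReal.tsum_le_tsum fun m => ?_
      rw [matOp_single, matOp_single]
      have h3 : ‖inner ℂ (a m y v) (a m x u)‖ₑ ≤ ‖a m y v‖ₑ * ‖a m x u‖ₑ := by
        rw [← ofReal_norm, ← ofReal_norm, ← ofReal_norm, ← ENNReal.ofReal_mul (norm_nonneg _)]
        exact ENNReal.ofReal_le_ofReal (norm_inner_le_norm _ _)
      refine h3.trans ((mul_le_mul' ((a m y).le_opENorm v) ((a m x).le_opENorm u)).trans_eq ?_)
      ring
    have h4 : ‖inner ℂ u u‖ₑ = ‖u‖ₑ * ‖u‖ₑ := by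
      rw [← ofReal_norm, ← ofReal_norm, ← ENNReal.ofReal_mul (norm_nonneg _),
        inner_self_eq_norm_sq_to_K, norm_pow, RCLike.norm_ofReal, abs_of_nonneg (norm_nonneg _),
        pow_two]
    rw [h4] at h2
    by_cases hu0 : ‖u‖ₑ = 0
    · rw [hu0]; exact zero_le
    · exact (ENNReal.mul_le_mul_iff_left hu0 enorm_ne_top).1 h2
  refine (mul_le_mul_left hent _).trans ?_
  rw [← ENNReal.tsum_mul_right]
  refine ENNReal.tsum_le_tsum fun m => ?_
  have h5 := slantDist_nonneg α m x
  have h6 := slantDist_nonneg α m y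
  have h7 := slantDist_nonneg 1 x y
  have h8 : ENNReal.ofReal ((1 + slantDist 1 x y) ^ (d + 1)) ≤
      ENNReal.ofReal ((1 + slantDist α m x) ^ (d + 1)) *
        ENNReal.ofReal ((1 + slantDist α m y) ^ (d + 1)) := by
    rw [← ENNReal.ofReal_mul (by positivity), ← mul_pow]
    refine ENNReal.ofReal_le_ofReal (pow_le_pow_left₀ (by linarith) ?_ _)
    have := slantDist_triangle' α m x y
    nlinarith
  refine (mul_le_mul_right h8 _).trans_eq ?_
  ring

/-- If a slanted matrix `A` is bounded below on one of the spaces `ℓ^p`, `𝔠₀`, then `A^* A` has an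
inverse that acts on all of them. On `ℓ^2` the inverse exists by Hilbert space theory; the pointwise
bound for the slanted matrix `A^* A` shows that its entries form a Schur kernel. -/
theorem exists_gram_inverse {α : ℝ} (hα : α ≠ 0) {a : Idx d → Idx d → (E →L[ℂ] F)}
    (ha : SlantedSchur α a) (p : Exponent) {c : ℝ} (hc : 0 < c)
    (hlow : ∀ f : SeqSpace d E p, c * ‖f‖ ≤
      ‖seqMap (matOp a ha.schurClass) (preserves_matOp a ha.schurClass) p f‖) :
    ∃ G : Linf d E →L[ℂ] Linf d E, Preserves G ∧
      (∀ f, adjOp (matOp a ha.schurClass) (preserves_matOp a ha.schurClass)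
        (matOp a ha.schurClass (G f)) = f) ∧
      ∀ f, G (adjOp (matOp a ha.schurClass) (preserves_matOp a ha.schurClass)
        (matOp a ha.schurClass f)) = f := by
  have hS := ha.schurClass
  set A := matOp a hS with hA
  set V := adjOp A (preserves_matOp a hS) with hV
  have hadj : IsAdj A V := isAdj_matOp a hS
  set M := V ∘L A with hM
  have hMM : IsAdj M M := hadj.symm.comp hadj
  -- lower bound of `A` on `ℓ^2`
  obtain ⟨c', hc', hlow'⟩ : ∃ c' : ℝ, 0 < c' ∧ ∀ f : SeqSpace d E Exponent.two,
      c' * ‖f‖ ≤ ‖seqMap A hadj.left _ f‖ := by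
    obtain ⟨K, C, hC, hK, hpt⟩ := exists_pointwise_bound hα ha p hc hlow
    refine ⟨(C.toReal + 1)⁻¹, by positivity, fun f => ?_⟩
    rw [inv_mul_le_iff₀ (by positivity)]
    have h1 := SchurBound.norm_le (C := C.toReal) ENNReal.toReal_nonneg
      (by rwa [ENNReal.ofReal_toReal hC]) (seqMap A hadj.left _ f) f
      fun x => hpt (toLinf _ f) x
    refine h1.trans ?_
    gcongr
    linarith
  obtain ⟨hunit, hMlow⟩ := isUnit_gram hadj hc' hlow'
  -- the pointwise bound for `M`
  have hb : SlantedSchur 1 (entry M) := slantedSchur_gram ha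
  have hMb : matOp (entry M) hb.schurClass = M :=
    (isAdj_matOp _ hb.schurClass).eq_of_single hMM fun n x =>
      lp.ext (funext fun m => matOp_single _ _ _ _ _)
  obtain ⟨K, C, hC, hK, hpt⟩ := exists_pointwise_bound one_ne_zero hb Exponent.two
    (pow_pos hc' 2) (by
      intro f
      refine (hMlow f).trans_eq ?_
      congr 1
      exact toLinf_injective _ (by rw [toLinf_seqMap, toLinf_seqMap, hMb]))
  rw [hMb] at hpt
  obtain ⟨R, hR⟩ := hunit.exists_right_inv
  have hMR : ∀ g : lp (fun _ : Idx d => E) 2, M (l2ToLinf (R g)) = l2ToLinf g := fun g => by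
    rw [← l2ToLinf_l2Map M hMM.left]
    congr 1
    exact congrArg (fun B : lp (fun _ : Idx d => E) 2 →L[ℂ] lp (fun _ : Idx d => E) 2 => B g) hR
  -- the matrix of the inverse on `ℓ^2`, which is dominated by the Schur kernel `K`
  let b : Idx d → Idx d → (E →L[ℂ] E) := fun x y =>
    lp.evalCLM ℂ (fun _ : Idx d => E) 2 x ∘L R ∘L
      lp.singleContinuousLinearMap ℂ (fun _ : Idx d => E) 2 y
  have hb_apply : ∀ x y h, b x y h = l2ToLinf (R (lp.single 2 y h)) x := fun _ _ _ => rfl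
  have hbK : ∀ x y, ‖b x y‖ₑ ≤ K x y := fun x y => by
    refine enorm_le_of_forall_enorm_le
      (ne_top_of_le_ne_top hC ((ENNReal.le_tsum y).trans (hK.1 x))) fun h => ?_
    refine (hpt (l2ToLinf (R (lp.single 2 y h))) x).trans_eq ?_
    rw [hMR, l2ToLinf_single, tsum_eq_single y]
    · simp
    · intro m hm
      simp [lp.single_apply, hm]
  have hbS : SchurClass b := ⟨C, hC, hK.mono hbK⟩
  have hMG : M ∘L matOp b hbS = ContinuousLinearMap.id ℂ _ := by
    refine (hMM.comp (isAdj_matOp b hbS)).eq_of_single IsAdj.id fun n x => ?_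
    have : matOp b hbS (lp.single ∞ n x) = l2ToLinf (R (lp.single 2 n x)) :=
      lp.ext (funext fun m => matOp_single _ _ _ _ _)
    rw [ContinuousLinearMap.comp_apply, this, hMR, l2ToLinf_single]
    rfl
  have hMG' : ∀ f, M (matOp b hbS f) = f := fun f => DFunLike.congr_fun hMG f
  refine ⟨matOp b hbS, preserves_matOp b hbS, hMG', fun f => ?_⟩
  -- `M` is injective on `ℓ^∞`
  have h1 : M (matOp b hbS (M f) - f) = 0 := by rw [map_sub, hMG', sub_self]
  rw [← sub_eq_zero]
  refine lp.ext (funext fun x => ?_)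
  have h2 := hpt (matOp b hbS (M f) - f) x
  rw [h1] at h2
  simp only [lp.coeFn_zero, Pi.zero_apply, enorm_zero, mul_zero, tsum_zero, nonpos_iff_eq_zero,
    enorm_eq_zero] at h2
  exact h2

end Hilbert

/-! ### Unconditional convergence in Hilbert space -/

/-- A series in a Hilbert space whose finite sums with bounded coefficients are bounded converges
unconditionally. Take a finite sum `z` whose norm is nearly maximal; for a further finite sum `y`
with disjoint indices, one of `z + y` and `z - y` has squared norm at least `‖z‖² + ‖y‖²`, so `y` is
small. -/
theorem summable_of_bounded_coeff {ι H : Type*} [NormedAddCommGroup H] [InnerProductSpace ℂ H]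
    [CompleteSpace H] {x : ι → H} {B : ℝ}
    (hB : ∀ (s : Finset ι) (ε : ι → ℂ), (∀ i, ‖ε i‖ ≤ 1) → ‖∑ i ∈ s, ε i • x i‖ ≤ B) :
    Summable x := by
  classical
  have hB0 : 0 ≤ B := (norm_nonneg _).trans (hB ∅ (fun _ => 0) (by simp))
  let V : Set ℝ := {v | ∃ (s : Finset ι) (ε : ι → ℂ), (∀ i, ‖ε i‖ ≤ 1) ∧
    v = ‖∑ i ∈ s, ε i • x i‖ ^ 2}
  have hVb : BddAbove V := ⟨B ^ 2, by
    rintro _ ⟨s, ε, hε, rfl⟩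
    exact pow_le_pow_left₀ (norm_nonneg _) (hB s ε hε) 2⟩
  have hVn : V.Nonempty := ⟨_, ∅, fun _ => 0, by simp, rfl⟩
  rw [summable_iff_vanishing_norm]
  intro δ hδ
  obtain ⟨_, ⟨s, ε, hε, rfl⟩, hlt⟩ := exists_lt_of_lt_csSup hVn
    (show sSup V - δ ^ 2 < sSup V by nlinarith)
  refine ⟨s, fun t ht => ?_⟩
  set z := ∑ i ∈ s, ε i • x i with hz
  set y := ∑ i ∈ t, x i with hy
  obtain ⟨σ, hσ, hre⟩ : ∃ σ : ℂ, ‖σ‖ = 1 ∧ 0 ≤ RCLike.re (inner ℂ z (σ • y)) := by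
    rcases le_total 0 (RCLike.re (inner ℂ z y)) with h | h
    · exact ⟨1, by simp, by simpa using h⟩
    · exact ⟨-1, by simp, by simpa using h⟩
  have hmem : ‖z + σ • y‖ ^ 2 ∈ V := by
    refine ⟨s ∪ t, fun i => if i ∈ s then ε i else σ, fun i => ?_, ?_⟩
    · dsimp only
      split_ifs
      · exact hε i
      · exact hσ.le
    · rw [Finset.sum_union ht.symm, hz, hy, Finset.smul_sum]
      congr 3
      · exact Finset.sum_congr rfl fun i hi => by simp only [if_pos hi]
      · exact Finset.sum_congr rfl fun i hi => by
          simp only [if_neg (Finset.disjoint_left.1 ht hi)]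
  have h1 := le_csSup hVb hmem
  have h2 : ‖z + σ • y‖ ^ 2 = ‖z‖ ^ 2 + 2 * RCLike.re (inner ℂ z (σ • y)) + ‖y‖ ^ 2 := by
    rw [norm_add_sq (𝕜 := ℂ), norm_smul, hσ, one_mul]
  have h3 : ‖y‖ ^ 2 < δ ^ 2 := by linarith
  exact lt_of_pow_lt_pow_left₀ 2 hδ.le h3

/-! ### Analysis and synthesis -/

/-- An element of `ℓ^1`, as an element of `ℓ^∞`. -/
def l1ToLinf {d : ℕ} {E : Type*} [NormedAddCommGroup E] (g : lp (fun _ : Idx d => E) 1) :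
    Linf d E :=
  ⟨fun n => g n, (lp.memℓp g).of_exponent_ge le_top⟩

theorem l1ToLinf_apply {d : ℕ} {E : Type*} [NormedAddCommGroup E]
    (g : lp (fun _ : Idx d => E) 1) (n : Idx d) : l1ToLinf g n = g n := rfl

section Synthesis

variable {d : ℕ} {H : Type*} [NormedAddCommGroup H] [InnerProductSpace ℂ H]

theorem toLinf_ofL1 (q : Exponent) (g : lp (fun _ : Idx d => H) 1) :
    toLinf q (ofL1 q g) = l1ToLinf g := rfl

/-- `P` is the analysis operator of `ψ` on `ℓ^∞`, and `Q` is its adjoint. -/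
structure IsAnalysisPair (ψ : Idx d → lp (fun _ : Idx d => H) 1) (P : Linf d H →L[ℂ] Linf d ℂ)
    (Q : Linf d ℂ →L[ℂ] Linf d H) : Prop where
  isAdj : IsAdj P Q
  apply_single : ∀ n, Q (lp.single ∞ n 1) = l1ToLinf (ψ n)

variable {ψ : Idx d → lp (fun _ : Idx d => H) 1} {P : Linf d H →L[ℂ] Linf d ℂ}
  {Q : Linf d ℂ →L[ℂ] Linf d H}

theorem IsAnalysisPair.apply_eq (h : IsAnalysisPair ψ P Q) (f : Linf d H) (n : Idx d) :
    P f n = analysis ψ (fun m => f m) n := by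
  have h1 := h.isAdj.pairing_of_right f (lp.single ∞ n 1) (memℓp_one_single n 1)
  rw [pairing_single_right, h.apply_single, RCLike.inner_apply, map_one, mul_one] at h1
  exact h1

theorem IsAnalysisPair.apply_single_smul (h : IsAnalysisPair ψ P Q) (n : Idx d) (c : ℂ) :
    Q (lp.single ∞ n c) = c • l1ToLinf (ψ n) := by
  rw [← h.apply_single, ← map_smul, ← lp.single_smul, smul_eq_mul, mul_one]

/-- The synthesis series `∑ c_n ψ^n` converges unconditionally in the weak* topology. -/
theorem IsAnalysisPair.hasWeakStarSum (h : IsAnalysisPair ψ P Q) (c : Linf d ℂ) :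
    HasWeakStarSum (fun n m => c n • ψ n m) (fun m => Q c m) := by
  intro g
  have hP : Memℓp (fun n => P (l1ToLinf g) n) 1 := h.isAdj.left.memℓp_one (lp.memℓp g)
  have h1 : HasSum (fun n => inner ℂ (P (l1ToLinf g) n) (c n))
      (pairing (fun n => c n) (fun n => P (l1ToLinf g) n)) :=
    (summable_inner (lp.memℓp c) hP).hasSum
  have h2 := h.isAdj.symm.pairing_of_right c (l1ToLinf g) (lp.memℓp g)
  change HasSum _ (pairing (fun m => Q c m) (fun m => l1ToLinf g m))
  rw [h2]
  convert h1 using 2 with n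
  have h3 : pairing (fun m => c n • ψ n m) (fun m => g m) =
      c n * pairing (fun m => ψ n m) (fun m => g m) := by
    simp only [pairing, inner_smul_right]
    rw [tsum_mul_left]
  rw [h3, ← conj_pairing, h.apply_eq, RCLike.inner_apply]
  rfl

/-- The synthesis series `∑ c_n ψ^n` converges coordinatewise, unconditionally in `H`. -/
theorem IsAnalysisPair.hasSum_apply [CompleteSpace H] (h : IsAnalysisPair ψ P Q) (c : Linf d ℂ)
    (m : Idx d) : HasSum (fun n => c n • ψ n m) (Q c m) := by
  have hs : Summable fun n => c n • ψ n m := by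
    refine summable_of_bounded_coeff (B := ‖Q‖ * ‖c‖) fun s ε hε => ?_
    have h1 : ∑ n ∈ s, ε n • c n • ψ n m = Q (∑ n ∈ s, lp.single ∞ n (ε n * c n)) m := by
      rw [map_sum, lp.coeFn_sum, Finset.sum_apply]
      refine Finset.sum_congr rfl fun n _ => ?_
      rw [h.apply_single_smul, lp.coeFn_smul, Pi.smul_apply, l1ToLinf_apply, mul_smul]
    rw [h1]
    refine (lp.norm_apply_le_norm (by simp) _ m).trans ((Q.le_opNorm _).trans ?_)
    refine mul_le_mul_of_nonneg_left (lp.norm_le_of_forall_le (norm_nonneg c) fun n => ?_)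
      (norm_nonneg _)
    rw [lp.coeFn_sum, Finset.sum_apply]
    simp only [lp.single_apply, Finset.sum_pi_single]
    split_ifs
    · rw [norm_mul]
      exact (mul_le_of_le_one_left (norm_nonneg _) (hε n)).trans
        (lp.norm_apply_le_norm (by simp) c n)
    · simp
  obtain ⟨l, hl⟩ := hs
  convert hl using 1
  refine ext_inner_left ℂ fun x => ?_
  have h1 := h.hasWeakStarSum c (lp.single 1 m x)
  have h2 : ∀ f : Idx d → H,
      pairing f (fun k => (lp.single 1 m x : lp (fun _ : Idx d => H) 1) k) = inner ℂ x (f m) :=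
    fun f => by
      rw [← pairing_single_right]
      simp only [lp.coeFn_single]
  simp only [h2] at h1
  exact h1.unique (hl.mapL (innerSL ℂ x))

/-- The synthesis series converges unconditionally, in norm for `𝔠₀` and `q < ∞` and in the weak*
topology for `q = ∞`. -/
theorem IsAnalysisPair.hasSeriesSum [CompleteSpace H] (h : IsAnalysisPair ψ P Q) (q : Exponent)
    (c : SeqSpace d ℂ q) :
    HasSeriesSum q (fun n => c.1 n • ofL1 q (ψ n)) (seqMap Q h.isAdj.right q c) := by
  refine ⟨fun hq => ?_, fun _ => h.hasWeakStarSum (toLinf q c)⟩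
  have h1 := (hasSum_seqSingle hq c).mapL (seqMap Q h.isAdj.right q)
  convert h1 using 2 with n
  refine toLinf_injective q ?_
  rw [toLinf_seqMap, toLinf_seqSingle, h.apply_single_smul, map_smul, toLinf_ofL1]

theorem IsAnalysisPair.isAnalysisOperator [CompleteSpace H] (h : IsAnalysisPair ψ P Q)
    (q : Exponent) : IsAnalysisOperator q ψ (seqMap P h.isAdj.left q) :=
  fun f n => h.apply_eq (toLinf q f) n

theorem IsAnalysisPair.isAdjointOperator [CompleteSpace H] (h : IsAnalysisPair ψ P Q)
    (q : Exponent) : IsAdjointOperator q ψ (seqMap Q h.isAdj.right q) :=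
  fun c m => h.hasSum_apply (toLinf q c) m

theorem IsAnalysisPair.functional_eq [CompleteSpace H] (h : IsAnalysisPair ψ P Q) (q : Exponent)
    (f : SeqSpace d H q) (n : Idx d) :
    functional q (ψ n) f = (seqMap P h.isAdj.left q f).1 n :=
  (h.apply_eq (toLinf q f) n).symm

/-! ### Frame inequalities -/

theorem IsFrame.exists_lower_bound {p : Exponent} (h : IsFrame p ψ) :
    ∃ c : ℝ, 0 < c ∧ ∀ (f : SeqSpace d H p) (g : SeqSpace d ℂ p),
      (∀ n, g.1 n = analysis ψ (fun m => f.1 m) n) → c * ‖f‖ ≤ ‖g‖ := by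
  obtain ⟨a, b, ha, -, h⟩ := h
  by_cases hp : p.1 = 0 ∨ p.1 = ∞
  · refine ⟨a, ha, fun f g hg => ?_⟩
    have h1 := h f
    rw [if_pos hp] at h1
    refine h1.2.1.trans (ciSup_le fun n => ?_)
    rw [← hg]
    exact lp.norm_apply_le_norm p.normExp_ne_zero g.1 n
  · obtain ⟨h0, ht⟩ := not_or.1 hp
    have hr : 0 < p.1.toReal := ENNReal.toReal_pos h0 ht
    refine ⟨a ^ p.1.toReal⁻¹, by positivity, fun f g hg => ?_⟩
    have h1 := h f
    rw [if_neg hp] at h1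
    have h2 := (SeqSpace.hasSum_norm h0 ht g).tsum_eq
    simp only [← hg] at h1
    rw [h2] at h1
    refine (Real.rpow_le_rpow_iff (by positivity) (norm_nonneg _) hr).1 (le_trans ?_ h1.2.1)
    rw [Real.mul_rpow (by positivity) (norm_nonneg _), ← Real.rpow_mul ha.le,
      inv_mul_cancel₀ hr.ne', Real.rpow_one]

theorem isFrame_of_lower_bound [CompleteSpace H] {q : Exponent}
    {T : SeqSpace d H q →L[ℂ] SeqSpace d ℂ q} (hT : IsAnalysisOperator q ψ T) {c : ℝ} (hc : 0 < c)
    (h : ∀ f, c * ‖f‖ ≤ ‖T f‖) : IsFrame q ψ := by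
  have hb : ∀ f, ‖T f‖ ≤ max c ‖T‖ * ‖f‖ := fun f =>
    (T.le_opNorm f).trans (mul_le_mul_of_nonneg_right (le_max_right _ _) (norm_nonneg _))
  have hC : 0 < max c ‖T‖ := lt_max_of_lt_left hc
  by_cases hq : q.1 = 0 ∨ q.1 = ∞
  · refine ⟨c, max c ‖T‖, hc, le_max_left _ _, fun f => ?_⟩
    rw [if_pos hq]
    simp only [← hT f]
    have hle : ∀ n, ‖(T f).1 n‖ ≤ ‖T f‖ := fun n =>
      lp.norm_apply_le_norm q.normExp_ne_zero (T f).1 n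
    have hbdd : BddAbove (Set.range fun n => ‖(T f).1 n‖) :=
      ⟨‖T f‖, by rintro _ ⟨n, rfl⟩; exact hle n⟩
    refine ⟨hbdd, (h f).trans ?_, (ciSup_le hle).trans (hb f)⟩
    exact (SeqSpace.norm_le_iff_top hq (T f) (Real.iSup_nonneg fun _ => norm_nonneg _)).2
      fun n => le_ciSup hbdd n
  · obtain ⟨h0, ht⟩ := not_or.1 hq
    have hr : 0 < q.1.toReal := ENNReal.toReal_pos h0 ht
    refine ⟨c ^ q.1.toReal, (max c ‖T‖) ^ q.1.toReal, by positivity,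
      Real.rpow_le_rpow hc.le (le_max_left _ _) hr.le, fun f => ?_⟩
    rw [if_neg hq]
    simp only [← hT f]
    have hs := SeqSpace.hasSum_norm h0 ht (T f)
    rw [hs.tsum_eq, ← Real.mul_rpow hc.le (norm_nonneg _), ← Real.mul_rpow hC.le (norm_nonneg _)]
    exact ⟨hs.summable, Real.rpow_le_rpow (by positivity) (h f) hr.le,
      Real.rpow_le_rpow (norm_nonneg _) (hb f) hr.le⟩

theorem IsAnalysisPair.isFrame [CompleteSpace H] (h : IsAnalysisPair ψ P Q)
    {L : Linf d ℂ →L[ℂ] Linf d H} (hL : Preserves L) (hLP : ∀ f, L (P f) = f) (q : Exponent) :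
    IsFrame q ψ := by
  refine isFrame_of_lower_bound (h.isAnalysisOperator q)
    (c := (‖seqMap L hL q‖ + 1)⁻¹) (by positivity) fun f => ?_
  rw [inv_mul_le_iff₀ (by positivity)]
  have h1 : seqMap L hL q (seqMap P h.isAdj.left q f) = f := toLinf_injective q (by simp [hLP])
  calc ‖f‖ = ‖seqMap L hL q (seqMap P h.isAdj.left q f)‖ := by rw [h1]
    _ ≤ ‖seqMap L hL q‖ * ‖seqMap P h.isAdj.left q f‖ := (seqMap L hL q).le_opNorm _
    _ ≤ _ := by gcongr; linarith

theorem IsAnalysisPair.isLocalizedFrame [CompleteSpace H] (h : IsAnalysisPair ψ P Q)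
    {L : Linf d ℂ →L[ℂ] Linf d H} (hL : Preserves L) (hLP : ∀ f, L (P f) = f) {s α : ℝ}
    (hs : 1 < s) (hα : α ≠ 0) {a : Idx d → Idx d → (H →L[ℂ] ℂ)}
    (ha : MemSigma α (polyWeight d s) a) {U U' : Linf d H →L[ℂ] Linf d H} (hU : Preserves U)
    (hU' : Preserves U') (h1 : ∀ f, U (U' f) = f) (h2 : ∀ f, U' (U f) = f)
    (hPU : ∀ f n, P (U f) n = ∑' m, a n m (f m)) (q : Exponent) : IsLocalizedFrame s α q ψ := by
  refine ⟨hs, hα, h.isFrame hL hLP q, ContinuousLinearEquiv.equivOfInverse U U' h2 h1,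
    fun q f => ⟨fun hf => ?_, fun hf => hU q f hf⟩, a, ha, fun f _ n => ?_⟩
  · have := hU' q _ hf
    rwa [ContinuousLinearEquiv.equivOfInverse_apply, h2] at this
  · rw [← hPU, h.apply_eq]
    rfl

end Synthesis

/-! ### Localized frames -/

section Localized

variable {d : ℕ} {H : Type*} [NormedAddCommGroup H] [InnerProductSpace ℂ H]

theorem isBanachFrame_of_leftInverse {q : Exponent} {φ : Idx d → lp (fun _ : Idx d => H) 1}
    {T : SeqSpace d H q →L[ℂ] SeqSpace d ℂ q} (hT : IsAnalysisOperator q φ T)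
    {L : SeqSpace d ℂ q →L[ℂ] SeqSpace d H q} (hL : ∀ f, L (T f) = f) :
    IsBanachFrame (SeqSpace.coord d ℂ q) (fun n => functional q (φ n)) := by
  refine ⟨fun f g h => Subtype.ext (lp.ext h), 1 + ‖T‖ + ‖L‖, ?_, L, fun f =>
    ⟨T f, funext fun n => hT f n, ?_, ?_, hL f⟩⟩
  · linarith [norm_nonneg T, norm_nonneg L]
  · have h1 : ‖f‖ ≤ ‖L‖ * ‖T f‖ := by
      conv_lhs => rw [← hL f]
      exact L.le_opNorm _
    rw [one_div, inv_mul_le_iff₀ (by positivity)]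
    refine h1.trans ?_
    gcongr
    linarith [norm_nonneg T]
  · refine (T.le_opNorm f).trans ?_
    gcongr
    linarith [norm_nonneg L]

variable [CompleteSpace H]

/-- The analysis operator of a localized frame, in a form that treats all the spaces `ℓ^q` and `𝔠₀`
at once: it is `A` times a weak* continuous isomorphism, and its Gram operator is invertible. -/
theorem IsLocalizedFrame.exists_isAnalysisPair {s α : ℝ} (hs : ((d : ℝ) + 1) ^ 2 < s)
    {φ : Idx d → lp (fun _ : Idx d => H) 1} {p : Exponent} (hφ : IsLocalizedFrame s α p φ) :
    ∃ (a : Idx d → Idx d → (H →L[ℂ] ℂ)) (T : Linf d H →L[ℂ] Linf d ℂ)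
      (V : Linf d ℂ →L[ℂ] Linf d H) (R W W' : Linf d H →L[ℂ] Linf d H),
      MemSigma α (polyWeight d s) a ∧ IsAnalysisPair φ T V ∧ Preserves R ∧ Preserves W ∧
      Preserves W' ∧ (∀ f, V (T (R f)) = f) ∧ (∀ f, R (V (T f)) = f) ∧ (∀ f, W (W' f) = f) ∧
      (∀ f, W' (W f) = f) ∧ ∀ f n, T (W f) n = ∑' m, a n m (f m) := by
  obtain ⟨-, hα, hframe, J, hJ, a, haS, hTJ⟩ := hφ
  have hds : (d : ℝ) + 1 ≤ s := by
    have : (0 : ℝ) ≤ d := Nat.cast_nonneg d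
    nlinarith
  have ha : SlantedSchur α a := haS.slantedSchur hα hds
  have hS := ha.schurClass
  set A := matOp a hS with hA
  have hAadj : IsAdj A (adjOp A (preserves_matOp a hS)) := isAdj_matOp a hS
  have hJp : Preserves (J : Linf d H →L[ℂ] Linf d H) := fun q f hf => (hJ q f).2 hf
  have hJs : Preserves (J.symm : Linf d H →L[ℂ] Linf d H) := fun q f hf => by
    refine (hJ q _).1 ?_
    have h1 : J ((J.symm : Linf d H →L[ℂ] Linf d H) f) = f := J.apply_symm_apply f
    rwa [h1]
  -- `A` is bounded below on `ℓ^p`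
  obtain ⟨c, hc, hlow⟩ : ∃ c : ℝ, 0 < c ∧ ∀ f : SeqSpace d H p,
      c * ‖f‖ ≤ ‖seqMap A hAadj.left p f‖ := by
    obtain ⟨c, hc, h⟩ := hframe.exists_lower_bound
    refine ⟨c * (‖seqMap _ hJs p‖ + 1)⁻¹, by positivity, fun f => ?_⟩
    have h1 := h (seqMap _ hJp p f) (seqMap A hAadj.left p f)
      fun n => (hTJ (toLinf p f) (memSeq_toLinf p f) n).symm
    have h2 : seqMap _ hJs p (seqMap _ hJp p f) = f := toLinf_injective p (by simp)
    have h3 : ‖f‖ ≤ (‖seqMap _ hJs p‖ + 1) * ‖seqMap _ hJp p f‖ := by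
      calc ‖f‖ = ‖seqMap _ hJs p (seqMap _ hJp p f)‖ := by rw [h2]
        _ ≤ ‖seqMap _ hJs p‖ * ‖seqMap _ hJp p f‖ := (seqMap _ hJs p).le_opNorm _
        _ ≤ _ := by gcongr; linarith
    refine le_trans ?_ h1
    rw [mul_assoc]
    gcongr
    rwa [inv_mul_le_iff₀ (by positivity)]
  set B := adjOp A (preserves_matOp a hS)
  obtain ⟨G, hG, hMG, hGM⟩ : ∃ G : Linf d H →L[ℂ] Linf d H, Preserves G ∧
      (∀ f, B (A (G f)) = f) ∧ ∀ f, G (B (A f)) = f := exists_gram_inverse hα ha p hc hlow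
  -- weak* continuous versions of `J` and of its inverse
  obtain ⟨W, hW, hWJ⟩ := exists_isAdj _ hJp
  obtain ⟨W', hW', hWJ'⟩ := exists_isAdj _ hJs
  set X := adjOp _ hJp
  set X' := adjOp _ hJs
  have hnull : ∀ (U : Linf d H →L[ℂ] Linf d H), Preserves U → ∀ (n : Idx d) (x : H),
      Tendsto (fun m => U (lp.single ∞ n x) m) cofinite (𝓝 0) := fun U hU n x =>
    (hU ⟨0, Or.inl rfl⟩ _ (memSeq_of_memℓp_one _ (memℓp_one_single n x))).2 rfl
  have hsing : ∀ (n : Idx d) (x : H),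
      Tendsto (fun m => (lp.single ∞ n x : Linf d H) m) cofinite (𝓝 0) := fun n x =>
    hnull _ IsAdj.id.left n x
  have hs1 : ∀ (n : Idx d) (x : H), (W ∘L W') (lp.single ∞ n x) =
      ContinuousLinearMap.id ℂ _ (lp.single ∞ n x) := fun n x => by
    rw [ContinuousLinearMap.comp_apply, hWJ' _ (hsing n x), hWJ _ (hnull _ hJs n x)]
    exact J.apply_symm_apply _
  have hs2 : ∀ (n : Idx d) (x : H), (W' ∘L W) (lp.single ∞ n x) =
      ContinuousLinearMap.id ℂ _ (lp.single ∞ n x) := fun n x => by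
    rw [ContinuousLinearMap.comp_apply, hWJ _ (hsing n x), hWJ' _ (hnull _ hJp n x)]
    exact J.symm_apply_apply _
  have hWW' : ∀ f, W (W' f) = f :=
    DFunLike.congr_fun ((hW.comp hW').eq_of_single IsAdj.id hs1)
  have hW'W : ∀ f, W' (W f) = f :=
    DFunLike.congr_fun ((hW'.comp hW).eq_of_single IsAdj.id hs2)
  have hX'X : ∀ f, X' (X f) = f :=
    DFunLike.congr_fun ((hW.comp hW').right_eq_of_single IsAdj.id hs1)
  have hXX' : ∀ f, X (X' f) = f :=
    DFunLike.congr_fun ((hW'.comp hW).right_eq_of_single IsAdj.id hs2)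
  have hT : IsAdj (A ∘L W') (X' ∘L B) := hAadj.comp hW'
  refine ⟨a, A ∘L W', X' ∘L B, W ∘L G ∘L X, W, W', haS, ⟨hT, fun n => ?_⟩,
    hW.left.comp (hG.comp hW.right), hW.left, hW'.left, fun f => ?_, fun f => ?_, hWW', hW'W,
    fun f n => ?_⟩
  · -- tested against unit sequences, where `W'` agrees with `J⁻¹`, this is the identity `T J = A`
    refine lp.ext (funext fun m => ext_inner_right ℂ fun x => ?_)
    rw [← pairing_single_left (fun m => (X' ∘L B) (lp.single ∞ n 1) m),
      ← hT.pairing_of_left _ _ (memℓp_one_single m x), pairing_single_right, RCLike.inner_apply,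
      map_one, mul_one, ContinuousLinearMap.comp_apply, hWJ' _ (hsing m x)]
    have h1 := hTJ (J.symm (lp.single ∞ m x)) (hJs p _ (memSeq_of_memℓp_one p
      (memℓp_one_single m x))) n
    rw [J.apply_symm_apply] at h1
    refine h1.symm.trans ?_
    rw [← pairing_single_left (fun m => l1ToLinf (φ n) m)]
    rfl
  · simp only [ContinuousLinearMap.comp_apply]
    rw [hW'W, hMG, hX'X]
  · simp only [ContinuousLinearMap.comp_apply]
    rw [hXX', hGM, hWW']
  · rw [ContinuousLinearMap.comp_apply, hW'W]
    rfl

end Localized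

end SlantedFrames

open SlantedFrames in
theorem mainTheorem3 (d : ℕ) (hd : 0 < d) {H : Type*} [NormedAddCommGroup H]
    [InnerProductSpace ℂ H] [CompleteSpace H] [TopologicalSpace.SeparableSpace H]
    (s α : ℝ) (hs : ((d : ℝ) + 1) ^ 2 < s)
    (φ : Idx d → lp (fun _ : Idx d => H) 1) (p : Exponent) (hφ : IsLocalizedFrame s α p φ) :
    ∃ φd : Idx d → lp (fun _ : Idx d => H) 1, ∀ q : Exponent,
      (∃ (T : SeqSpace d H q →L[ℂ] SeqSpace d ℂ q) (Tstar : SeqSpace d ℂ q →L[ℂ] SeqSpace d H q)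
          (S : SeqSpace d H q ≃L[ℂ] SeqSpace d H q) (Tsharp : SeqSpace d ℂ q →L[ℂ] SeqSpace d H q),
        -- the operators `T`, `T^*`, the invertible `T^* T`, and `T^♯ = (T^* T)⁻¹ T^*`
        IsAnalysisOperator q φ T ∧ IsAdjointOperator q φ Tstar ∧
        (∀ f, S f = Tstar (T f)) ∧ (∀ c, Tsharp c = S.symm (Tstar c)) ∧
        -- `T` is left invertible
        (∃ L : SeqSpace d ℂ q →L[ℂ] SeqSpace d H q, L ∘L T = ContinuousLinearMap.id ℂ _) ∧
        -- the canonical dual (one sequence in `ℓ^1` for all `q`)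
        (∀ n, ofL1 q (φd n) = S.symm (ofL1 q (φ n))) ∧
        -- the reconstruction formula
        (∀ f, Tsharp (T f) = f) ∧
        (∀ f, HasSeriesSum q (fun n => functional q (φ n) f • ofL1 q (φd n)) f) ∧
        (∀ f, HasSeriesSum q (fun n => functional q (φd n) f • ofL1 q (φ n)) f)) ∧
      -- both sequences are localized frames
      IsLocalizedFrame s α q φ ∧ IsLocalizedFrame s α q φd ∧
      -- Banach frame property
      IsBanachFrame (SeqSpace.coord d ℂ q) (fun n => functional q (φ n)) := by
  have h1s : 1 < s ∧ α ≠ 0 := ⟨hφ.1, hφ.2.1⟩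
  obtain ⟨a, T, V, R, W, W', ha, hT, hR, hW, hW', hSR, hRS, hWW', hW'W, hTW⟩ :=
    hφ.exists_isAnalysisPair hs
  have hTp := hT.isAdj.left
  have hVp := hT.isAdj.right
  have hRR : IsAdj R R := (hT.isAdj.symm.comp hT.isAdj).inverse hR hSR
  -- the canonical dual sequence and its analysis operator `T (T^* T)⁻¹`
  let φd : Idx d → lp (fun _ : Idx d => H) 1 := fun n =>
    ⟨fun m => R (l1ToLinf (φ n)) m, hR.memℓp_one (lp.memℓp (φ n))⟩
  have hTd : IsAnalysisPair φd (T ∘L R) (R ∘L V) :=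
    ⟨hT.isAdj.comp hRR, fun n => by
      rw [ContinuousLinearMap.comp_apply, hT.apply_single]
      rfl⟩
  have hL1 : ∀ f, (R ∘L V) (T f) = f := hRS
  have hL2 : ∀ f, V ((T ∘L R) f) = f := hSR
  have hL1p : Preserves (R ∘L V) := hR.comp hVp
  refine ⟨φd, fun q => ⟨?_, ?_, ?_, ?_⟩⟩
  · let S : SeqSpace d H q ≃L[ℂ] SeqSpace d H q := ContinuousLinearEquiv.equivOfInverse
      (seqMap V hVp q ∘L seqMap T hTp q) (seqMap R hR q)
      (fun f => toLinf_injective q (by simp [hRS])) (fun f => toLinf_injective q (by simp [hSR]))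
    have hrec : ∀ f, seqMap (R ∘L V) hL1p q (seqMap T hTp q f) = f := fun f =>
      toLinf_injective q (hRS _)
    refine ⟨seqMap T hTp q, seqMap V hVp q, S, seqMap (R ∘L V) hL1p q, hT.isAnalysisOperator q,
      hT.isAdjointOperator q, fun f => rfl, fun c => toLinf_injective q rfl,
      ⟨seqMap (R ∘L V) hL1p q, ContinuousLinearMap.ext hrec⟩,
      fun n => toLinf_injective q rfl, hrec, fun f => ?_, fun f => ?_⟩
    · have h := hTd.hasSeriesSum q (seqMap T hTp q f)
      simp only [hT.functional_eq q f]
      convert h using 1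
      exact (hrec f).symm
    · have h := hT.hasSeriesSum q (seqMap (T ∘L R) hTd.isAdj.left q f)
      simp only [hTd.functional_eq q f]
      convert h using 1
      exact (toLinf_injective q (hSR _)).symm
  · exact hT.isLocalizedFrame hL1p hL1 h1s.1 h1s.2 ha hW hW' hWW' hW'W hTW q
  · refine hTd.isLocalizedFrame hVp hL2 h1s.1 h1s.2 ha
      (U := (V ∘L T) ∘L W) (U' := W' ∘L R) ((hVp.comp hTp).comp hW) (hW'.comp hR)
      (fun f => ?_) (fun f => ?_) (fun f n => ?_) q
    · simp only [ContinuousLinearMap.comp_apply]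
      rw [hWW', hSR]
    · simp only [ContinuousLinearMap.comp_apply]
      rw [hRS, hW'W]
    · simp only [ContinuousLinearMap.comp_apply]
      rw [hRS, hTW]
  · exact isBanachFrame_of_leftInverse (hT.isAnalysisOperator q)
      (L := seqMap (R ∘L V) hL1p q) fun f => toLinf_injective q (hRS _)
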